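/- Let $\mathbb{R}_S$ be the Grassmann algebra over $\mathbb{R}$ with countably many anticommuting generators $\beta_{[1]},\beta_{[2]},\dots$: its elements are the formal sums $x=\sum_{\lambda}x_\lambda\beta_{[\lambda]}$ over all finite multi-indices $\lambda=\lambda_1<\dots<\lambda_k$, with $x_\lambda\in\mathbb{R}$, and $\mathbb{R}_S=\mathbb{R}_{S_0}\oplus\mathbb{R}_{S_1}$ is the decomposition into even and odd elements. Let $\epsilon(x)$ be the constant term of $x$ and $\sigma(x)=x-\epsilon(x)$. Open sets of $\mathbb{R}_S^{1,0}=\mathbb{R}_{S_0}$ are the sets $\epsilon^{-1}(V)$, $V\subseteq\mathbb{R}$ open (DeWitt topology); a function $f:U\to\mathbb{R}_S$ on such a set is $G^\infty$ if $f(x)=\widehat g(x):=\sum_{i\ge 0}\frac{1}{i!}g^{(i)}(\epsilon(x))\,\sigma(x)^i$ for some function $g:\epsilon(U)\to\mathbb{R}_S$ with $C^\infty$ coefficients, and then its derivative is $Df:=\widehat{g'}$. Let $$S^{1,0}=\{(x,y)\in\mathbb{R}_{S_0}\times\mathbb{R}_{S_0}\mid x^2+y^2=1\}$$ be the supercircle,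 with the four charts $(x,y)\mapsto y$ on $\{\pm\epsilon(x)>0\}$ and $(x,y)\mapsto x$ on $\{\pm\epsilon(y)>0\}$. The tangent space $T_pS^{1,0}$ is the left $\mathbb{R}_S$-module of sums of an even and an odd $\mathbb{R}_S$-linear superderivation at $p$ of the algebra of $\mathbb{R}_S$-valued functions that are $G^\infty$ near $p$; the tangent bundle is $TS^{1,0}=\bigsqcup_p T_pS^{1,0}$, and a vector field is $G^\infty$ if it maps $G^\infty$ functions on open sets to $G^\infty$ functions. **Proposition 4.4.** The tangent bundle of the supercircle is trivial. More precisely: 1. The four charts make $S^{1,0}$ a $(1,0)$-dimensional $G^\infty$ supermanifold. 2. For all $\theta\in\mathbb{R}_{S_0}$ the formal series $$\overline{\sin}\,\theta=\sum_{i=0}^\infty(-1)^i\frac{\theta^{2i+1}}{(2i+1)!},\qquad \overline{\cos}\,\theta=\sum_{i=0}^\infty(-1)^i\frac{\theta^{2i}}{(2i)!}$$ converge coefficient by coefficient. The functions $\overline{\sin},\overline{\cos}$ are $G^\infty$ on $\mathbb{R}_{S_0}$, with $D\,\overline{\sin}=\overline{\cos}$ and $D\,\overline{\cos}=-\overline{\sin}$,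 and $\theta\mapsto(\overline{\cos}\,\theta,\overline{\sin}\,\theta)$ is a map from $\mathbb{R}_{S_0}$ onto $S^{1,0}$. 3. The coordinate functions $x,y$ are $G^\infty$ near each point, and sending a tangent vector $v$ at $(x,y)$ to $(x,y,v(x),v(y))$ is a bijection from $TS^{1,0}$ onto $$\{(x,y,-\lambda y,\lambda x)\mid(x,y)\in S^{1,0},\ \lambda\in\mathbb{R}_S\}.$$ 4. The map $v\mapsto\bigl((x,y),\lambda\bigr)$, where $v(x)=-\lambda y$ and $v(y)=\lambda x$, is an isomorphism of $G^\infty$ super vector bundles $TS^{1,0}\cong S^{1,0}\times\mathbb{R}_S$ over $S^{1,0}$: it is bijective, $\mathbb{R}_S$-linear and degree preserving on each fibre, and a vector field is $G^\infty$ on an open set if and only if the corresponding $\mathbb{R}_S$-valued function is. -/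

import Mathlib

open scoped ContDiff

namespace SuperGeom

noncomputable section

/-- The Grassmann algebra `ℝ_S` over `ℝ` with countably many generators `β_[1], β_[2], …`
(here indexed by `ℕ`).  A multi-index `λ₁ < ⋯ < λ_k` is the finite set `{λ₁, …, λ_k}`, and an element
is a formal sum `∑ x_λ β_[λ]` over all multi-indices, i.e. an arbitrary family of real coefficients. -/
@[ext] structure RS : Type where
  /-- the coefficients `x_λ` -/
  coeff : Finset ℕ → ℝ

namespace RS

instance : CoeFun RS (fun _ => Finset ℕ → ℝ) := ⟨RS.coeff⟩

instance : Zero RS := ⟨⟨fun _ => 0⟩⟩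
instance : Add RS := ⟨fun x y => ⟨fun l => x l + y l⟩⟩
instance : Neg RS := ⟨fun x => ⟨fun l => -x l⟩⟩
instance : Sub RS := ⟨fun x y => ⟨fun l => x l - y l⟩⟩
instance : SMul ℝ RS := ⟨fun c x => ⟨fun l => c * x l⟩⟩

theorem ext' {x y : RS} (h : ∀ l : Finset ℕ, x l = y l) : x = y := RS.ext (funext h)

@[simp] theorem add_apply (x y : RS) (l : Finset ℕ) : (x + y) l = x l + y l := rfl
@[simp] theorem sub_apply (x y : RS) (l : Finset ℕ) : (x - y) l = x l - y l := rfl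
@[simp] theorem neg_apply (x : RS) (l : Finset ℕ) : (-x) l = -x l := rfl
@[simp] theorem zero_apply (l : Finset ℕ) : (0 : RS) l = 0 := rfl
@[simp] theorem smul_apply (c : ℝ) (x : RS) (l : Finset ℕ) : (c • x) l = c * x l := rfl

/-- The sign with `β_[μ] β_[ν] = sgn μ ν • β_[μ ∪ ν]` for disjoint `μ, ν`: the parity of the number of
transpositions of neighbours that sort the concatenation of `μ` and `ν`. -/
def sgn (μ ν : Finset ℕ) : ℝ := (-1) ^ ((μ ×ˢ ν).filter fun p => p.2 < p.1).card

theorem sgn_union_left {μ ν : Finset ℕ} (h : Disjoint μ ν) (ρ : Finset ℕ) :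
    sgn (μ ∪ ν) ρ = sgn μ ρ * sgn ν ρ := by
  unfold sgn
  rw [← pow_add, Finset.union_product, Finset.filter_union, Finset.card_union_of_disjoint]
  exact Finset.disjoint_filter_filter (Finset.disjoint_product.2 (Or.inl h))

theorem sgn_union_right {ν ρ : Finset ℕ} (h : Disjoint ν ρ) (μ : Finset ℕ) :
    sgn μ (ν ∪ ρ) = sgn μ ν * sgn μ ρ := by
  unfold sgn
  rw [← pow_add, Finset.product_union, Finset.filter_union, Finset.card_union_of_disjoint]
  exact Finset.disjoint_filter_filter (Finset.disjoint_product.2 (Or.inr h))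

@[simp] theorem sgn_empty_left (μ : Finset ℕ) : sgn ∅ μ = 1 := by simp [sgn]
@[simp] theorem sgn_empty_right (μ : Finset ℕ) : sgn μ ∅ = 1 := by simp [sgn]

theorem sgn_swap {μ ν : Finset ℕ} (h : Disjoint μ ν) :
    sgn ν μ = (-1) ^ (μ.card * ν.card) * sgn μ ν := by
  have h1 : ((ν ×ˢ μ).filter fun p => p.2 < p.1).card
      = ((μ ×ˢ ν).filter fun p => ¬ p.2 < p.1).card := by
    refine Finset.card_bij' (fun p _ => (p.2, p.1)) (fun p _ => (p.2, p.1)) ?_ ?_ ?_ ?_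
    · rintro ⟨a, b⟩ hab
      simp only [Finset.mem_filter, Finset.mem_product] at hab ⊢
      exact ⟨⟨hab.1.2, hab.1.1⟩, by omega⟩
    · rintro ⟨a, b⟩ hab
      simp only [Finset.mem_filter, Finset.mem_product] at hab ⊢
      have := Finset.disjoint_left.1 h hab.1.1
      exact ⟨⟨hab.1.2, hab.1.1⟩, lt_of_le_of_ne (not_lt.1 hab.2) (by rintro rfl; exact this hab.1.2)⟩
    · simp
    · simp
  have h2 := Finset.card_filter_add_card_filter_not (s := μ ×ˢ ν) (fun p => p.2 < p.1)
  rw [Finset.card_product] at h2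
  unfold sgn
  rw [h1, ← h2, pow_add]
  have h3 : ((-1 : ℝ) ^ ((μ ×ˢ ν).filter fun p => p.2 < p.1).card) *
    ((-1 : ℝ) ^ ((μ ×ˢ ν).filter fun p => p.2 < p.1).card) = 1 := by
    rw [← mul_pow]; norm_num
  linear_combination (-((-1 : ℝ) ^ ((μ ×ˢ ν).filter fun p => ¬ p.2 < p.1).card)) * h3

/-- The product of formal sums: `(xy)_λ = ∑ ± x_μ y_ν` over the decompositions `λ = μ ⊔ ν`. -/
instance : Mul RS :=
  ⟨fun x y => ⟨fun l => ∑ m ∈ l.powerset, sgn m (l \ m) * x m * y (l \ m)⟩⟩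

instance : One RS := ⟨⟨fun l => if l = ∅ then 1 else 0⟩⟩

theorem mul_apply (x y : RS) (l : Finset ℕ) :
    (x * y) l = ∑ m ∈ l.powerset, sgn m (l \ m) * x m * y (l \ m) := rfl

theorem one_apply (l : Finset ℕ) : (1 : RS) l = if l = ∅ then 1 else 0 := rfl

theorem one_mul' (x : RS) : 1 * x = x := by
  refine ext' fun l => ?_
  rw [mul_apply, Finset.sum_eq_single ∅]
  · simp [one_apply]
  · intro m _ hm; simp [one_apply, hm]
  · simp

theorem mul_one' (x : RS) : x * 1 = x := by
  refine ext' fun l => ?_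
  rw [mul_apply, Finset.sum_eq_single l]
  · simp [one_apply]
  · intro m hm hml
    have : l \ m ≠ ∅ := by
      intro h
      exact hml (Finset.Subset.antisymm (Finset.mem_powerset.1 hm) (Finset.sdiff_eq_empty_iff_subset.1 h))
    simp [one_apply, this]
  · simp

theorem mul_assoc' (x y z : RS) : x * y * z = x * (y * z) := by
  refine ext' fun l => ?_
  simp only [mul_apply, Finset.sum_mul, Finset.mul_sum]
  rw [Finset.sum_sigma', Finset.sum_sigma']
  refine Finset.sum_bij' (fun p _ => ⟨p.2, p.1 \ p.2⟩) (fun p _ => ⟨p.1 ∪ p.2, p.1⟩) ?_ ?_ ?_ ?_ ?_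
  · rintro ⟨k, m⟩ h
    simp only [Finset.mem_sigma, Finset.mem_powerset] at h ⊢
    exact ⟨h.2.trans h.1, Finset.sdiff_subset_sdiff h.1 subset_rfl⟩
  · rintro ⟨m, n⟩ h
    simp only [Finset.mem_sigma, Finset.mem_powerset] at h ⊢
    exact ⟨Finset.union_subset h.1 (h.2.trans Finset.sdiff_subset), Finset.subset_union_left⟩
  · rintro ⟨k, m⟩ h
    simp only [Finset.mem_sigma, Finset.mem_powerset] at h
    simp [Finset.union_sdiff_of_subset h.2]
  · rintro ⟨m, n⟩ h
    simp only [Finset.mem_sigma, Finset.mem_powerset] at h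
    have hd : Disjoint n m := Finset.disjoint_of_subset_left h.2 Finset.sdiff_disjoint
    simp [Finset.union_sdiff_cancel_left hd.symm]
  · rintro ⟨k, m⟩ h
    simp only [Finset.mem_sigma, Finset.mem_powerset] at h
    obtain ⟨hk, hm⟩ := h
    have e1 : (l \ m) \ (k \ m) = l \ k := by
      ext a; simp only [Finset.mem_sdiff]
      have := @hm a
      tauto
    have e2 : l \ m = (k \ m) ∪ (l \ k) := by
      ext a; simp only [Finset.mem_sdiff, Finset.mem_union]
      have := @hm a
      have := @hk a
      tauto
    have d1 : Disjoint m (k \ m) := Finset.disjoint_sdiff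
    have d2 : Disjoint (k \ m) (l \ k) :=
      Finset.disjoint_of_subset_left Finset.sdiff_subset Finset.disjoint_sdiff
    have s1 : sgn k (l \ k) = sgn m (l \ k) * sgn (k \ m) (l \ k) := by
      rw [← sgn_union_left d1, Finset.union_sdiff_of_subset hm]
    have s2 : sgn m (l \ m) = sgn m (k \ m) * sgn m (l \ k) := by
      rw [e2, sgn_union_right d2]
    simp only [e1]
    rw [s1, s2]; ring

instance : Ring RS where
  add_assoc _ _ _ := ext' fun _ => add_assoc _ _ _
  zero_add _ := ext' fun _ => zero_add _
  add_zero _ := ext' fun _ => add_zero _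
  add_comm _ _ := ext' fun _ => add_comm _ _
  neg_add_cancel _ := ext' fun _ => neg_add_cancel _
  sub_eq_add_neg _ _ := ext' fun _ => sub_eq_add_neg _ _
  nsmul := nsmulRec
  zsmul := zsmulRec
  one_mul := one_mul'
  mul_one := mul_one'
  mul_assoc := mul_assoc'
  zero_mul x := by refine ext' fun l => ?_; simp [mul_apply]
  mul_zero x := by refine ext' fun l => ?_; simp [mul_apply]
  left_distrib x y z := by
    refine ext' fun l => ?_; simp only [mul_apply, add_apply, ← Finset.sum_add_distrib]
    exact Finset.sum_congr rfl fun _ _ => by ring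
  right_distrib x y z := by
    refine ext' fun l => ?_; simp only [mul_apply, add_apply, ← Finset.sum_add_distrib]
    exact Finset.sum_congr rfl fun _ _ => by ring

instance : Module ℝ RS where
  one_smul _ := ext' fun _ => one_mul _
  mul_smul _ _ _ := ext' fun _ => mul_assoc _ _ _
  smul_zero _ := ext' fun _ => mul_zero _
  smul_add _ _ _ := ext' fun _ => mul_add _ _ _
  add_smul _ _ _ := ext' fun _ => add_mul _ _ _
  zero_smul _ := ext' fun _ => zero_mul _

instance : Algebra ℝ RS :=
  Algebra.ofModule
    (fun r x y => by
      refine ext' fun l => ?_; simp only [mul_apply, smul_apply, Finset.mul_sum]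
      exact Finset.sum_congr rfl fun _ _ => by ring)
    (fun r x y => by
      refine ext' fun l => ?_; simp only [mul_apply, smul_apply, Finset.mul_sum]
      exact Finset.sum_congr rfl fun _ _ => by ring)

/-- The homogeneous components: `part 0 = ℝ_{S₀}` (even elements) and `part 1 = ℝ_{S₁}` (odd
elements); only the coefficients at multi-indices of length `≡ d` mod 2 may be nonzero. -/
def part (d : ZMod 2) : Submodule ℝ RS where
  carrier := {x | ∀ l : Finset ℕ, (l.card : ZMod 2) ≠ d → x l = 0}
  add_mem' hx hy l hl := by simp [hx l hl, hy l hl]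
  zero_mem' l _ := rfl
  smul_mem' c x hx l hl := by simp [hx l hl]

theorem card_sdiff_cast {m l : Finset ℕ} (h : m ⊆ l) :
    (l.card : ZMod 2) = (m.card : ZMod 2) + ((l \ m).card : ZMod 2) := by
  rw [← Nat.cast_add, add_comm, Finset.card_sdiff_add_card_eq_card h]

theorem mul_mem_part {a b : ZMod 2} {x y : RS} (hx : x ∈ part a) (hy : y ∈ part b) :
    x * y ∈ part (a + b) := by
  intro l hl
  rw [mul_apply]
  refine Finset.sum_eq_zero fun m hm => ?_
  have hc := card_sdiff_cast (Finset.mem_powerset.1 hm)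
  by_cases h : (m.card : ZMod 2) = a
  · by_cases h' : ((l \ m).card : ZMod 2) = b
    · exact absurd (by rw [hc, h, h']) hl
    · simp [hy _ h']
  · simp [hx _ h]

theorem one_mem_part : (1 : RS) ∈ part 0 := by
  intro l hl
  rw [one_apply, if_neg]
  rintro rfl
  simp at hl

/-- The sign `(-1)^{ab}` attached to two degrees. -/
def koszul (a b : ZMod 2) : ℝ := (-1) ^ (a.val * b.val)

theorem koszul_natCast (m n : ℕ) : koszul m n = (-1) ^ (m * n) := by
  unfold koszul
  rw [ZMod.val_natCast, ZMod.val_natCast]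
  rcases Nat.even_or_odd m with hm | hm <;> rcases Nat.even_or_odd n with hn | hn
  · simp [Nat.even_iff.1 hm, (hm.mul_right n).neg_one_pow]
  · simp [Nat.even_iff.1 hm, (hm.mul_right n).neg_one_pow]
  · simp [Nat.even_iff.1 hn, (hn.mul_left m).neg_one_pow]
  · simp [Nat.odd_iff.1 hn, Nat.odd_iff.1 hm, (hm.mul hn).neg_one_pow]

theorem koszul_add_left (a b c : ZMod 2) : koszul (a + b) c = koszul a c * koszul b c := by
  have key : ∀ a b c : ZMod 2, ((a + b).val * c.val) % 2 = (a.val * c.val + b.val * c.val) % 2 := by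
    decide
  unfold koszul
  rw [← pow_add, neg_one_pow_eq_pow_mod_two, key, ← neg_one_pow_eq_pow_mod_two]

/-- `ℝ_S` is super commutative. -/
theorem supercomm {a b : ZMod 2} {x y : RS} (hx : x ∈ part a) (hy : y ∈ part b) :
    x * y = koszul a b • (y * x) := by
  refine ext' fun l => ?_
  rw [smul_apply, mul_apply, mul_apply, Finset.mul_sum]
  refine Finset.sum_bij' (fun m _ => l \ m) (fun m _ => l \ m) ?_ ?_ ?_ ?_ ?_
  · intro m _; simp
  · intro m _; simp
  · intro m hm; simpa using Finset.mem_powerset.1 hm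
  · intro m hm; simpa using Finset.mem_powerset.1 hm
  · intro m hm
    have hm' := Finset.mem_powerset.1 hm
    have e : l \ (l \ m) = m := by simpa using hm'
    rw [e]
    by_cases h : (m.card : ZMod 2) = a
    · by_cases h' : ((l \ m).card : ZMod 2) = b
      · subst h h'
        rw [koszul_natCast, sgn_swap (Finset.disjoint_sdiff (s := m) (t := l))]
        have : ((-1 : ℝ) ^ (m.card * (l \ m).card)) * ((-1 : ℝ) ^ (m.card * (l \ m).card)) = 1 := by
          rw [← mul_pow]; norm_num
        linear_combination (-(sgn m (l \ m) * x m * y (l \ m))) * this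
      · simp [hy _ h']
    · simp [hx _ h]

/-- The homogeneous component of degree `d`. -/
def proj (d : ZMod 2) (x : RS) : RS := ⟨fun l => if (l.card : ZMod 2) = d then x l else 0⟩

theorem proj_mem (d : ZMod 2) (x : RS) : proj d x ∈ part d := fun _ hl => if_neg hl

theorem proj_add_proj (x : RS) : proj 0 x + proj 1 x = x := by
  refine ext' fun l => ?_
  simp only [add_apply, proj]
  have : (l.card : ZMod 2) = 0 ∨ (l.card : ZMod 2) = 1 := by
    generalize (l.card : ZMod 2) = a
    revert a
    decide
  rcases this with h | h <;> simp [h]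

/-- `ℝ_{S₀}` as a subalgebra of `ℝ_S`. -/
def evenSubalgebra : Subalgebra ℝ RS where
  __ := part 0
  mul_mem' hx hy := by simpa using mul_mem_part hx hy
  algebraMap_mem' r := by
    rw [Algebra.algebraMap_eq_smul_one]
    exact (part 0).smul_mem r one_mem_part

/-- The body map `ε`, as a real number. -/
def body (x : RS) : ℝ := x ∅

/-- The soul `σ(x) = x - ε(x)`. -/
def soul (x : RS) : RS := x - algebraMap ℝ RS (body x)

/-- The formal sum of a sequence: the series is summed coefficient by coefficient. -/
def formalSum (a : ℕ → RS) : RS := ⟨fun l => ∑' i, a i l⟩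

/-- A formal series in `ℝ_S` is meaningful if each coefficient is given by a convergent series. -/
def FormallySummable (a : ℕ → RS) : Prop := ∀ l : Finset ℕ, Summable fun i => a i l

end RS

open RS

/-! ### Supersmooth functions of one even variable -/

/-- The real superspace `ℝ_S^{1,0} = ℝ_{S₀}`. -/
abbrev R10 : Type := evenSubalgebra

/-- Open sets of the DeWitt topology: preimages of open sets of `ℝ` under the body map. -/
def IsDeWittOpen (U : Set R10) : Prop :=
  ∃ V : Set ℝ, IsOpen V ∧ U = {x : R10 | body (x : RS) ∈ V}

/-- An `ℝ_S`-valued function of a real variable is `C^∞` at `t` if each coefficient is. -/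
def SmoothAt (f : ℝ → RS) (t : ℝ) : Prop :=
  ∀ l : Finset ℕ, ContDiffAt ℝ ∞ (fun s => f s l) t

/-- The `i`-th derivative of an `ℝ_S`-valued function of a real variable. -/
def realDeriv (i : ℕ) (f : ℝ → RS) (t : ℝ) : RS := ⟨fun l => iteratedDeriv i (fun s => f s l) t⟩

/-- The terms `f^{(i)}(ε(x)) σ(x)^i / i!` of the Grassmann analytic continuation. -/
def hatTerm (f : ℝ → RS) (x : R10) (i : ℕ) : RS :=
  (1 / (i.factorial : ℝ)) • (realDeriv i f (body (x : RS)) * soul (x : RS) ^ i)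

/-- The Grassmann analytic continuation of `f`. (As `σ(x)` has no constant term, only the terms with
`i ≤ l(λ)` contribute to the coefficient at `λ`.) -/
def hat (f : ℝ → RS) (x : R10) : RS := formalSum (hatTerm f x)

/-- `f` is `G^∞` on the (DeWitt open) set `U`: it is the Grassmann analytic continuation of a function
that is `C^∞` on the body of `U`. -/
def IsGInftyOn (U : Set R10) (f : R10 → RS) : Prop :=
  ∃ g : ℝ → RS, (∀ x ∈ U, SmoothAt g (body (x : RS))) ∧ ∀ x ∈ U, f x = hat g x

/-- `f` is `G^∞` on the (DeWitt open) set `U`, and `f'` is its derivative `∂_E f` along the even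
coordinate: the derivative of the continuation of `g` is the continuation of the derivative of `g`. -/
def HasSuperDerivOn (U : Set R10) (f f' : R10 → RS) : Prop :=
  ∃ g : ℝ → RS, (∀ x ∈ U, SmoothAt g (body (x : RS))) ∧ (∀ x ∈ U, f x = hat g x) ∧
    ∀ x ∈ U, f' x = hat (realDeriv 1 g) x

/-! Sums and products of `G^∞` functions are `G^∞`. -/

theorem soul_mem (x : R10) : soul (x : RS) ∈ part 0 :=
  (part 0).sub_mem x.2 (evenSubalgebra.algebraMap_mem _)

theorem soul_pow_mem (x : R10) (i : ℕ) : soul (x : RS) ^ i ∈ part 0 :=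
  evenSubalgebra.pow_mem (soul_mem x) i

theorem even_comm {x : RS} (hx : x ∈ part 0) (y : RS) : x * y = y * x := by
  rw [← proj_add_proj y, mul_add, add_mul, supercomm hx (proj_mem 0 y), supercomm hx (proj_mem 1 y)]
  simp [koszul]

theorem soul_empty (x : RS) : soul x ∅ = 0 := by
  simp [soul, body, Algebra.algebraMap_eq_smul_one, one_apply]

theorem mul_soul_pow_eq_zero (x : RS) (i : ℕ) :
    ∀ (a : RS) (l : Finset ℕ), l.card < i → (a * soul x ^ i) l = 0 := by
  induction i with
  | zero => intro a l h; omega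
  | succ k ih =>
    intro a l h
    rw [pow_succ, ← mul_assoc, mul_apply]
    refine Finset.sum_eq_zero fun m hm => ?_
    have hm' := Finset.mem_powerset.1 hm
    by_cases hml : m = l
    · subst hml; simp [soul_empty]
    · have : m.card < l.card := Finset.card_lt_card (lt_of_le_of_ne hm' hml)
      rw [ih a m (by omega)]; simp

theorem hatTerm_eq_zero (f : ℝ → RS) (x : R10) (i : ℕ) (l : Finset ℕ) (h : l.card < i) :
    hatTerm f x i l = 0 := by
  simp [hatTerm, mul_soul_pow_eq_zero _ _ _ _ h]

theorem RS.sum_apply {α : Type} (s : Finset α) (a : α → RS) (l : Finset ℕ) :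
    (∑ i ∈ s, a i) l = ∑ i ∈ s, a i l := by
  classical
  induction s using Finset.induction_on with
  | empty => simp
  | insert i s hi ih => rw [Finset.sum_insert hi, Finset.sum_insert hi, add_apply, ih]

theorem hat_apply (f : ℝ → RS) (x : R10) (l : Finset ℕ) (N : ℕ) (h : l.card < N) :
    hat f x l = (∑ i ∈ Finset.range N, hatTerm f x i) l := by
  rw [RS.sum_apply]
  refine tsum_eq_sum fun i hi => hatTerm_eq_zero f x i l ?_
  simp only [Finset.mem_range] at hi
  omega

theorem SmoothAt.add {f g : ℝ → RS} {t : ℝ} (hf : SmoothAt f t) (hg : SmoothAt g t) :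
    SmoothAt (f + g) t := fun l => (hf l).add (hg l)

theorem SmoothAt.mul {f g : ℝ → RS} {t : ℝ} (hf : SmoothAt f t) (hg : SmoothAt g t) :
    SmoothAt (f * g) t := fun l =>
  ContDiffAt.sum fun m _ => (contDiffAt_const.mul (hf m)).mul (hg (l \ m))

theorem SmoothAt.const (c : RS) (t : ℝ) : SmoothAt (fun _ => c) t := fun _ => contDiffAt_const

theorem realDeriv_add {f g : ℝ → RS} {t : ℝ} (hf : SmoothAt f t) (hg : SmoothAt g t) (n : ℕ) :
    realDeriv n (f + g) t = realDeriv n f t + realDeriv n g t :=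
  ext' fun l => iteratedDeriv_fun_add ((hf l).of_le (mod_cast le_top))
    ((hg l).of_le (mod_cast le_top))

theorem realDeriv_mul {f g : ℝ → RS} {t : ℝ} (hf : SmoothAt f t) (hg : SmoothAt g t) (n : ℕ) :
    realDeriv n (f * g) t =
      ∑ i ∈ Finset.range (n + 1), (n.choose i : ℝ) • (realDeriv i f t * realDeriv (n - i) g t) := by
  refine ext' fun l => ?_
  rw [RS.sum_apply]
  simp only [smul_apply, mul_apply, Finset.mul_sum]
  rw [Finset.sum_comm]
  have hn : ∀ {h : ℝ → RS}, SmoothAt h t → ∀ m, ContDiffAt ℝ n (fun s => h s m) t :=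
    fun hh m => (hh m).of_le (mod_cast le_top)
  change iteratedDeriv n (fun s => ∑ m ∈ l.powerset, sgn m (l \ m) * f s m * g s (l \ m)) t = _
  rw [iteratedDeriv_fun_sum fun m _ => (contDiffAt_const.mul (hn hf m)).mul (hn hg _)]
  refine Finset.sum_congr rfl fun m _ => ?_
  have e : (fun s => sgn m (l \ m) * f s m * g s (l \ m)) =
      fun s => sgn m (l \ m) * ((fun s => f s m) s * (fun s => g s (l \ m)) s) := by
    funext s; ring
  rw [e, iteratedDeriv_const_mul _ ((hn hf m).mul (hn hg _)),
    iteratedDeriv_fun_mul (hn hf m) (hn hg _), Finset.mul_sum]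
  refine Finset.sum_congr rfl fun i _ => ?_
  simp only [realDeriv]
  ring

theorem hat_add {f g : ℝ → RS} {x : R10} (hf : SmoothAt f (body (x : RS)))
    (hg : SmoothAt g (body (x : RS))) : hat (f + g) x = hat f x + hat g x := by
  refine ext' fun l => ?_
  rw [add_apply, hat_apply _ x l _ (Nat.lt_succ_self _), hat_apply f x l _ (Nat.lt_succ_self _),
    hat_apply g x l _ (Nat.lt_succ_self _), ← add_apply, ← Finset.sum_add_distrib]
  congr 2
  funext i
  rw [hatTerm, realDeriv_add hf hg, add_mul, smul_add]; rfl

theorem hat_mul {f g : ℝ → RS} {x : R10} (hf : SmoothAt f (body (x : RS)))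
    (hg : SmoothAt g (body (x : RS))) : hat (f * g) x = hat f x * hat g x := by
  refine ext' fun l => ?_
  set N := l.card + 1 with hN
  have h1 : (hat f x * hat g x) l =
      ((∑ i ∈ Finset.range N, hatTerm f x i) * (∑ i ∈ Finset.range N, hatTerm g x i)) l := by
    rw [mul_apply, mul_apply]
    refine Finset.sum_congr rfl fun m hm => ?_
    have hm' := Finset.card_le_card (Finset.mem_powerset.1 hm)
    have hm'' := Finset.card_le_card (Finset.sdiff_subset (s := l) (t := m))
    rw [hat_apply f x m N (by omega), hat_apply g x (l \ m) N (by omega)]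
  have hterm : ∀ i j, hatTerm f x i * hatTerm g x j =
      ((1 / (i.factorial : ℝ)) * (1 / (j.factorial : ℝ))) •
        (realDeriv i f (body (x : RS)) * realDeriv j g (body (x : RS)) * soul (x : RS) ^ (i + j)) := by
    intro i j
    simp only [hatTerm, smul_mul_smul_comm, pow_add]
    congr 1
    rw [mul_assoc, ← mul_assoc (soul (x : RS) ^ i), even_comm (soul_pow_mem x i)]
    simp only [mul_assoc]
  have h2 : ∀ n, hatTerm (f * g) x n =
      ∑ i ∈ Finset.range (n + 1), hatTerm f x i * hatTerm g x (n - i) := by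
    intro n
    rw [hatTerm, realDeriv_mul hf hg, Finset.sum_mul, Finset.smul_sum]
    refine Finset.sum_congr rfl fun i hi => ?_
    have hi' : i ≤ n := by simpa [Nat.lt_succ_iff] using hi
    rw [hterm, Nat.add_sub_cancel' hi', smul_mul_assoc, smul_smul]
    congr 1
    rw [Nat.cast_choose ℝ hi']
    field_simp
  rw [h1, hat_apply _ x l N (by omega), Finset.sum_congr rfl fun n _ => h2 n,
    Finset.sum_range_diag_flip N fun i j => hatTerm f x i * hatTerm g x j, Finset.sum_mul_sum,
    RS.sum_apply, RS.sum_apply]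
  refine Finset.sum_congr rfl fun i _ => ?_
  rw [RS.sum_apply, RS.sum_apply]
  refine Finset.sum_subset (Finset.range_mono (Nat.sub_le _ _)) fun j _ hj => ?_
  simp only [Finset.mem_range] at hj
  rw [hterm, smul_apply, mul_soul_pow_eq_zero _ _ _ _ (by omega), mul_zero]

theorem hat_const (c : RS) (x : R10) : hat (fun _ => c) x = c := by
  refine ext' fun l => ?_
  rw [hat_apply _ x l (l.card + 1) (Nat.lt_succ_self _), RS.sum_apply,
    Finset.sum_eq_single 0]
  · simp [hatTerm, realDeriv]
  · intro i _ hi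
    have : realDeriv i (fun _ => c) (body (x : RS)) = 0 := by
      refine ext' fun m => ?_
      simp [realDeriv, iteratedDeriv_const, hi]
    simp [hatTerm, this]
  · simp

theorem IsGInftyOn.add {U : Set R10} {f g : R10 → RS} (hf : IsGInftyOn U f) (hg : IsGInftyOn U g) :
    IsGInftyOn U (f + g) := by
  obtain ⟨a, ha, ha'⟩ := hf
  obtain ⟨b, hb, hb'⟩ := hg
  refine ⟨a + b, fun x hx => (ha x hx).add (hb x hx), fun x hx => ?_⟩
  rw [hat_add (ha x hx) (hb x hx), Pi.add_apply, ha' x hx, hb' x hx]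

theorem IsGInftyOn.mul {U : Set R10} {f g : R10 → RS} (hf : IsGInftyOn U f) (hg : IsGInftyOn U g) :
    IsGInftyOn U (f * g) := by
  obtain ⟨a, ha, ha'⟩ := hf
  obtain ⟨b, hb, hb'⟩ := hg
  refine ⟨a * b, fun x hx => (ha x hx).mul (hb x hx), fun x hx => ?_⟩
  rw [hat_mul (ha x hx) (hb x hx), Pi.mul_apply, ha' x hx, hb' x hx]

theorem IsGInftyOn.const (U : Set R10) (c : RS) : IsGInftyOn U fun _ => c :=
  ⟨fun _ => c, fun _ _ => SmoothAt.const c _, fun x _ => (hat_const c x).symm⟩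

theorem IsGInftyOn.mono {U V : Set R10} {f : R10 → RS} (hf : IsGInftyOn U f) (h : V ⊆ U) :
    IsGInftyOn V f := by
  obtain ⟨a, ha, ha'⟩ := hf
  exact ⟨a, fun x hx => ha x (h hx), fun x hx => ha' x (h hx)⟩

/-! ### Supermanifolds of dimension `(1,0)` -/

/-- A family of charts on a set `X` with values in `ℝ_S^{1,0}`; only the values of `map i` on `dom i`
matter. -/
structure ChartData (X : Type) where
  /-- the indices of the charts -/
  ι : Type
  /-- the domains of the charts -/
  dom : ι → Set X
  /-- the coordinate maps -/
  map : ι → X → R10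

variable {X : Type}

/-- The charts form a `G^∞` atlas, that is, `X` with these charts is an
`(ℝ_S^{1,0}, DeWitt, G^∞)`-supermanifold. -/
structure IsSupermanifold (C : ChartData X) : Prop where
  cover : ∀ p, ∃ i, p ∈ C.dom i
  injOn : ∀ i, Set.InjOn (C.map i) (C.dom i)
  isOpen_image : ∀ i, IsDeWittOpen (C.map i '' C.dom i)
  isOpen_inter : ∀ i j, IsDeWittOpen (C.map i '' (C.dom i ∩ C.dom j))
  transition : ∀ i j, ∃ f : R10 → RS, IsGInftyOn (C.map i '' (C.dom i ∩ C.dom j)) f ∧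
    ∀ p ∈ C.dom i ∩ C.dom j, (C.map j p : RS) = f (C.map i p)

/-- The open sets of the topology on `X` given by the charts: those `W` for which each `W ∩ dom i`
is the preimage of a DeWitt open set under the chart. -/
def IsOpenIn (C : ChartData X) (W : Set X) : Prop :=
  ∀ i, ∃ O : Set R10, IsDeWittOpen O ∧ W ∩ C.dom i = C.map i ⁻¹' O ∩ C.dom i

/-- `u` is `G^∞` on the open set `W`: it is so in each chart. -/
def GInftyOn (C : ChartData X) (W : Set X) (u : X → RS) : Prop :=
  ∀ i, ∃ f : R10 → RS, IsGInftyOn (C.map i '' (W ∩ C.dom i)) f ∧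
    ∀ p ∈ W ∩ C.dom i, u p = f (C.map i p)

theorem isOpenIn_univ (C : ChartData X) : IsOpenIn C Set.univ := fun i =>
  ⟨Set.univ, ⟨Set.univ, isOpen_univ, by simp⟩, by simp⟩

theorem IsOpenIn.inter {C : ChartData X} {W W' : Set X} (h : IsOpenIn C W) (h' : IsOpenIn C W') :
    IsOpenIn C (W ∩ W') := by
  intro i
  obtain ⟨O, ⟨V, hV, rfl⟩, e⟩ := h i
  obtain ⟨O', ⟨V', hV', rfl⟩, e'⟩ := h' i
  refine ⟨_, ⟨V ∩ V', hV.inter hV', rfl⟩, ?_⟩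
  rw [Set.inter_inter_distrib_right, e, e']
  ext p
  simp only [Set.mem_inter_iff, Set.mem_preimage, Set.mem_ofPred_eq]
  tauto

theorem GInftyOn.mono {C : ChartData X} {W W' : Set X} {u : X → RS} (h : GInftyOn C W u)
    (hs : W' ⊆ W) : GInftyOn C W' u := by
  intro i
  obtain ⟨f, hf, hu⟩ := h i
  exact ⟨f, hf.mono (Set.image_mono (Set.inter_subset_inter_left _ hs)),
    fun p hp => hu p ⟨hs hp.1, hp.2⟩⟩

theorem GInftyOn.add {C : ChartData X} {W : Set X} {u v : X → RS} (hu : GInftyOn C W u)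
    (hv : GInftyOn C W v) : GInftyOn C W (u + v) := by
  intro i
  obtain ⟨f, hf, hf'⟩ := hu i
  obtain ⟨g, hg, hg'⟩ := hv i
  exact ⟨f + g, hf.add hg, fun p hp => by simp [hf' p hp, hg' p hp]⟩

theorem GInftyOn.mul {C : ChartData X} {W : Set X} {u v : X → RS} (hu : GInftyOn C W u)
    (hv : GInftyOn C W v) : GInftyOn C W (u * v) := by
  intro i
  obtain ⟨f, hf, hf'⟩ := hu i
  obtain ⟨g, hg, hg'⟩ := hv i
  exact ⟨f * g, hf.mul hg, fun p hp => by simp [hf' p hp, hg' p hp]⟩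

theorem GInftyOn.const (C : ChartData X) (W : Set X) (c : RS) : GInftyOn C W fun _ => c := fun _ =>
  ⟨fun _ => c, IsGInftyOn.const _ c, fun _ _ => rfl⟩

/-- The functions that are `G^∞` on a neighbourhood of `p`. -/
def gInftyAt (C : ChartData X) (p : X) : Subring (X → RS) where
  carrier := {u | ∃ W, IsOpenIn C W ∧ p ∈ W ∧ GInftyOn C W u}
  mul_mem' := by
    rintro u v ⟨W, hW, hp, hu⟩ ⟨W', hW', hp', hv⟩
    exact ⟨W ∩ W', hW.inter hW', ⟨hp, hp'⟩, (hu.mono Set.inter_subset_left).mul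
      (hv.mono Set.inter_subset_right)⟩
  one_mem' := ⟨Set.univ, isOpenIn_univ C, trivial, GInftyOn.const C _ 1⟩
  add_mem' := by
    rintro u v ⟨W, hW, hp, hu⟩ ⟨W', hW', hp', hv⟩
    exact ⟨W ∩ W', hW.inter hW', ⟨hp, hp'⟩, (hu.mono Set.inter_subset_left).add
      (hv.mono Set.inter_subset_right)⟩
  zero_mem' := ⟨Set.univ, isOpenIn_univ C, trivial, GInftyOn.const C _ 0⟩
  neg_mem' := by
    rintro u ⟨W, hW, hp, hu⟩
    refine ⟨W, hW, hp, ?_⟩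
    have := (GInftyOn.const C W (-1)).mul hu
    have e : (fun _ => (-1 : RS)) * u = -u := by funext q; simp
    rwa [e] at this

/-- A constant, as a function that is `G^∞` near `p`. -/
def constAt (C : ChartData X) (p : X) (c : RS) : gInftyAt C p :=
  ⟨fun _ => c, Set.univ, isOpenIn_univ C, trivial, GInftyOn.const C _ c⟩

/-! ### The tangent bundle -/

/-- `D` is a homogeneous tangent vector of degree `d` at `p`: an `ℝ_S`-linear superderivation at `p` of
degree `d` on the functions that are `G^∞` near `p`.  Linearity refers to the right module structure.
(The value `D u` only depends on the germ of `u` at `p`: if `u = 0` on a neighbourhood `W` of `p`, then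
`u = u χ` with `χ = 0` on `W` and `χ = 1` elsewhere, and the Leibniz rule gives `D u = 0`.) -/
structure IsSuperDerivation (C : ChartData X) (p : X) (d : ZMod 2) (D : gInftyAt C p → RS) : Prop where
  map_add : ∀ u v, D (u + v) = D u + D v
  map_mul_const : ∀ u c, D (u * constAt C p c) = D u * c
  degree : ∀ (e : ZMod 2) (u : gInftyAt C p), (∀ q, (u : X → RS) q ∈ part e) → D u ∈ part (d + e)
  leibniz : ∀ (e : ZMod 2) (u v : gInftyAt C p), (∀ q, (u : X → RS) q ∈ part e) →
    D (u * v) = D u * (v : X → RS) p + koszul d e • ((u : X → RS) p * D v)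

theorem IsSuperDerivation.add {C : ChartData X} {p : X} {d : ZMod 2} {D D' : gInftyAt C p → RS}
    (h : IsSuperDerivation C p d D) (h' : IsSuperDerivation C p d D') :
    IsSuperDerivation C p d (D + D') where
  map_add u v := by simp only [Pi.add_apply, h.map_add, h'.map_add]; abel
  map_mul_const u c := by simp only [Pi.add_apply, h.map_mul_const, h'.map_mul_const, add_mul]
  degree e u hu := (part _).add_mem (h.degree e u hu) (h'.degree e u hu)
  leibniz e u v hu := by
    simp only [Pi.add_apply, h.leibniz e u v hu, h'.leibniz e u v hu, add_mul, mul_add, smul_add]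
    abel

theorem IsSuperDerivation.zero (C : ChartData X) (p : X) (d : ZMod 2) :
    IsSuperDerivation C p d 0 where
  map_add u v := by simp
  map_mul_const u c := by simp
  degree e u hu := (part _).zero_mem
  leibniz e u v hu := by simp

theorem IsSuperDerivation.smul {C : ChartData X} {p : X} {a d : ZMod 2} {c : RS} (hc : c ∈ part a)
    {D : gInftyAt C p → RS} (h : IsSuperDerivation C p d D) :
    IsSuperDerivation C p (a + d) (c • D) where
  map_add u v := by simp only [Pi.smul_apply, smul_eq_mul, h.map_add, mul_add]
  map_mul_const u c := by simp only [Pi.smul_apply, smul_eq_mul, h.map_mul_const, mul_assoc]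
  degree e u hu := by
    rw [add_assoc]
    exact mul_mem_part hc (h.degree e u hu)
  leibniz e u v hu := by
    simp only [Pi.smul_apply, smul_eq_mul, h.leibniz e u v hu, mul_add, mul_smul_comm, mul_assoc]
    rw [← mul_assoc c ((u : X → RS) p), supercomm hc (hu p), koszul_add_left, smul_mul_assoc, smul_smul, mul_assoc,
      mul_comm (koszul d e)]

/-- The tangent space `T_p X`: all sums of an even and an odd superderivation at `p`, as a left
`ℝ_S`-module with `(c D)(u) = c D(u)`. -/
def SuperTangentSpace (C : ChartData X) (p : X) : Submodule RS (gInftyAt C p → RS) where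
  carrier := {D | ∃ D₀ D₁, IsSuperDerivation C p 0 D₀ ∧ IsSuperDerivation C p 1 D₁ ∧ D = D₀ + D₁}
  add_mem' := by
    rintro _ _ ⟨D₀, D₁, h₀, h₁, rfl⟩ ⟨E₀, E₁, k₀, k₁, rfl⟩
    exact ⟨D₀ + E₀, D₁ + E₁, h₀.add k₀, h₁.add k₁, by abel⟩
  zero_mem' := ⟨0, 0, IsSuperDerivation.zero C p 0, IsSuperDerivation.zero C p 1, by simp⟩
  smul_mem' := by
    rintro c _ ⟨D₀, D₁, h₀, h₁, rfl⟩
    refine ⟨proj 0 c • D₀ + proj 1 c • D₁, proj 0 c • D₁ + proj 1 c • D₀, ?_, ?_, ?_⟩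
    · exact (h₀.smul (proj_mem 0 c)).add (h₁.smul (proj_mem 1 c))
    · have := (h₁.smul (proj_mem 0 c)).add (h₀.smul (proj_mem 1 c))
      simpa using this
    · conv_lhs => rw [← proj_add_proj c]
      rw [add_smul, smul_add, smul_add]; abel

/-- The total space of the tangent bundle. -/
abbrev SuperTangentBundle (C : ChartData X) : Type := Σ p : X, SuperTangentSpace C p

/-- The vector field `Y` is `G^∞` on the open set `W`: it maps each function `u` that is `G^∞` on an
open subset `W'` of `W` to a function `Y u` that is `G^∞` on `W'`. -/
def IsGInftyField (C : ChartData X) (W : Set X) (Y : ∀ p : X, SuperTangentSpace C p) : Prop :=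
  ∀ W' ⊆ W, ∀ (hW' : IsOpenIn C W') (u : X → RS) (hu : GInftyOn C W' u),
    ∃ w : X → RS, GInftyOn C W' w ∧
      ∀ (p : X) (hp : p ∈ W'), (Y p).1 ⟨u, W', hW', hp, hu⟩ = w p

/-- `Φ` is an isomorphism of `G^∞` super vector bundles over `X` from the tangent bundle to the trivial
bundle `X × ℝ_S`: it is the identity on the base, `ℝ_S`-linear and degree preserving on each fibre,
and it identifies the `G^∞` local sections of both bundles. -/
structure IsTrivialization (C : ChartData X) (Φ : SuperTangentBundle C ≃ X × RS) : Prop where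
  base : ∀ v, (Φ v).1 = v.1
  map_add : ∀ (p : X) (v w : SuperTangentSpace C p), (Φ ⟨p, v + w⟩).2 = (Φ ⟨p, v⟩).2 + (Φ ⟨p, w⟩).2
  map_smul : ∀ (p : X) (c : RS) (v : SuperTangentSpace C p), (Φ ⟨p, c • v⟩).2 = c * (Φ ⟨p, v⟩).2
  degree : ∀ (d : ZMod 2) (p : X) (v : SuperTangentSpace C p),
    IsSuperDerivation C p d v.1 ↔ (Φ ⟨p, v⟩).2 ∈ part d
  smooth : ∀ W, IsOpenIn C W → ∀ Y : ∀ p : X, SuperTangentSpace C p,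
    IsGInftyField C W Y ↔ GInftyOn C W fun p => (Φ ⟨p, Y p⟩).2

/-! ### The supercircle -/

/-- The supercircle `S^{1,0} = {(x, y) ∈ ℝ_S^{2,0} | x² + y² = 1}`. -/
def Supercircle : Type := {p : R10 × R10 // p.1 ^ 2 + p.2 ^ 2 = 1}

namespace Supercircle

/-- The coordinate function `x`. -/
def x (p : Supercircle) : R10 := p.1.1

/-- The coordinate function `y`. -/
def y (p : Supercircle) : R10 := p.1.2

/-- The function `x` with values in `ℝ_S`. -/
def fx (p : Supercircle) : RS := p.x

/-- The function `y` with values in `ℝ_S`. -/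
def fy (p : Supercircle) : RS := p.y

/-- Names for the four charts. -/
inductive Chart : Type
  | xpos
  | xneg
  | ypos
  | yneg

/-- The four charts: `y` where `ε(x) > 0` or `ε(x) < 0`, and `x` where `ε(y) > 0` or `ε(y) < 0`. -/
def charts : ChartData Supercircle where
  ι := Chart
  dom
    | .xpos => {p | 0 < body (p.x : RS)}
    | .xneg => {p | body (p.x : RS) < 0}
    | .ypos => {p | 0 < body (p.y : RS)}
    | .yneg => {p | body (p.y : RS) < 0}
  map
    | .xpos => y
    | .xneg => y
    | .ypos => x
    | .yneg => x

end Supercircle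

/-- The terms of the super sine series. -/
def sinTerm (θ : R10) (i : ℕ) : RS := ((-1) ^ i / ((2 * i + 1).factorial : ℝ)) • (θ : RS) ^ (2 * i + 1)

/-- The terms of the super cosine series. -/
def cosTerm (θ : R10) (i : ℕ) : RS := ((-1) ^ i / ((2 * i).factorial : ℝ)) • (θ : RS) ^ (2 * i)

/-- The super sine. -/
def sinBar (θ : R10) : RS := formalSum (sinTerm θ)

/-- The super cosine. -/
def cosBar (θ : R10) : RS := formalSum (cosTerm θ)

end

end SuperGeom

open SuperGeom

/-!
Everything is pulled back along the angle `γ θ = (cos θ, sin θ)`, where the super cosine and sine are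
the Grassmann analytic continuations of the real functions: expanding `θ = ε(θ) + σ(θ)` in the power
series and collecting the powers of `σ(θ)` gives the Taylor series of `cos` and `sin` at `ε(θ)`
(`hasSum_taylor_hat`).

Grassmann analytic continuation is compatible with products and with composition (`hat_comp`). Hence
`arcsin`, `π - arcsin`, `arccos` and `-arccos` continue to functions on the images of the four charts
which, followed by `γ`, invert the charts (`Supercircle.angle_branch_coord`). This yields the atlas, the
surjectivity of `γ`, and the criterion that a function on the supercircle is `G^∞` exactly if its
pullback along `γ` is (`Supercircle.hat_pull`, `Supercircle.gInftyOn_of_hat`).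

Differentiation in the angle defines an even superderivation at each point, with `x ↦ -y` and `y ↦ x`.
A superderivation `D` at a point is determined by its value on the coordinate `s` of a chart. By Hadamard's
lemma a function near the point has the form `c + (s - a) h` with `a` the body of the coordinate, so
`D` of it is `D s` times the value of `h`, plus the soul of the coordinate times `D h`; iterating, the error
is divisible by arbitrarily high powers of the soul and vanishes coefficient by coefficient
(`eq_zero_of_soul_mul`, `Supercircle.map_hatAt`). The same induction proves `hat_comp`. The relation
`x² + y² = 1` forces `D x = -λ y` and `D y = λ x` with `λ = D y · x - D x · y`, so that `D` is `λ` times the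
derivative in the angle, and `λ` is the trivializing parameter.
-/

namespace SuperGeom

open RS Filter Topology

/-! ### Hadamard's lemma -/

theorem hasDerivAt_integral_pow_mul_comp {g : ℝ → ℝ} (hg : ContDiff ℝ 1 g) (k : ℕ) (a t : ℝ) :
    HasDerivAt (fun t => ∫ s in (0 : ℝ)..1, s ^ k * g (a + s * (t - a)))
      (∫ s in (0 : ℝ)..1, s ^ (k + 1) * deriv g (a + s * (t - a))) t := by
  have hg0 : Continuous g := hg.continuous
  have hg1 : Continuous (deriv g) := hg.continuous_deriv le_rfl
  have hc : Continuous fun q : ℝ × ℝ => q.2 ^ (k + 1) * deriv g (a + q.2 * (q.1 - a)) := by fun_prop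
  obtain ⟨B, hB⟩ := ((isCompact_closedBall t 1).prod (isCompact_Icc (a := (0 : ℝ)) (b := 1))
    ).exists_bound_of_continuousOn hc.continuousOn
  refine (intervalIntegral.hasDerivAt_integral_of_dominated_loc_of_deriv_le
    (F := fun t s => s ^ k * g (a + s * (t - a)))
    (F' := fun t s => s ^ (k + 1) * deriv g (a + s * (t - a))) (bound := fun _ => B)
    (Metric.ball_mem_nhds t one_pos) (.of_forall fun x => ?_) ?_ ?_ ?_ (by simp) ?_).2
  · exact Continuous.aestronglyMeasurable (by fun_prop)
  · exact Continuous.intervalIntegrable (by fun_prop) _ _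
  · exact Continuous.aestronglyMeasurable (by fun_prop)
  · refine .of_forall fun s hs x hx => hB (x, s) ⟨Metric.ball_subset_closedBall hx, ?_⟩
    rw [Set.uIoc_of_le zero_le_one] at hs
    exact Set.Ioc_subset_Icc_self hs
  · refine .of_forall fun s _ x _ => ?_
    have h1 : HasDerivAt (fun x : ℝ => a + s * (x - a)) s x := by
      simpa using (((hasDerivAt_id x).sub_const a).const_mul s).const_add a
    have h2 : HasDerivAt g (deriv g (a + s * (x - a))) (a + s * (x - a)) :=
      (hg.differentiable one_ne_zero _).hasDerivAt
    convert! (h2.comp x h1).const_mul (s ^ k) using 1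
    ring

theorem contDiff_integral_pow_mul_comp (n : ℕ) : ∀ {g : ℝ → ℝ}, ContDiff ℝ n g → ∀ (k : ℕ) (a : ℝ),
    ContDiff ℝ n fun t => ∫ s in (0 : ℝ)..1, s ^ k * g (a + s * (t - a)) := by
  induction n with
  | zero =>
    intro g hg k a
    have hg0 : Continuous g := hg.continuous
    exact contDiff_zero.2
      (intervalIntegral.continuous_parametric_intervalIntegral_of_continuous' (by fun_prop) _ _)
  | succ n ih =>
    intro g hg k a
    have h1 : ContDiff ℝ 1 g := hg.of_le (by norm_cast; omega)
    have hd := hasDerivAt_integral_pow_mul_comp h1 k a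
    push_cast at hg ⊢
    rw [contDiff_succ_iff_deriv] at hg ⊢
    refine ⟨fun t => (hd t).differentiableAt, by simp, ?_⟩
    rw [funext fun t => (hd t).deriv]
    exact ih hg.2.2 (k + 1) a

/-- A function that is `C^n` near `a` has the same germ at `a` as a globally `C^n` function. -/
theorem exists_contDiff_eventuallyEq {n : ℕ} {f : ℝ → ℝ} {a : ℝ} (hf : ContDiffAt ℝ n f a) :
    ∃ g : ℝ → ℝ, ContDiff ℝ n g ∧ g =ᶠ[𝓝 a] f := by
  obtain ⟨r, hr, hfr⟩ := Metric.eventually_nhds_iff_ball.1 (hf.eventually (by simp))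
  let χ : ContDiffBump a := ⟨r / 4, r / 2, by positivity, by linarith⟩
  refine ⟨fun t => χ t * f t, contDiff_iff_contDiffAt.2 fun t => ?_, ?_⟩
  · by_cases ht : t ∈ tsupport χ
    · refine χ.contDiffAt.mul (hfr t ?_)
      rw [χ.tsupport_eq] at ht
      exact Metric.closedBall_subset_ball (by simp only [χ]; linarith) ht
    · refine contDiffAt_const (c := 0) |>.congr_of_eventuallyEq ?_
      filter_upwards [notMem_tsupport_iff_eventuallyEq.1 ht] with s hs
      simp [hs]
  · filter_upwards [χ.eventuallyEq_one] with t ht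
    simp [ht]

/-- Hadamard's lemma: the difference quotient `t ↦ (f t - f a) / (t - a)` is smooth at `a`. On a
`C^{n+1}` extension of `f` it is `∫₀¹ f' (a + s (t - a)) ds`. -/
theorem contDiffAt_dslope {f : ℝ → ℝ} {a : ℝ} (hf : ContDiffAt ℝ ∞ f a) :
    ContDiffAt ℝ ∞ (dslope f a) a := by
  refine contDiffAt_infty.2 fun n => ?_
  obtain ⟨g, hg, hgf⟩ := exists_contDiff_eventuallyEq (contDiffAt_infty.1 hf (n + 1))
  have h1 : ContDiff ℝ 1 g := hg.of_le (by norm_cast; omega)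
  have hg' : ContDiff ℝ n (deriv g) := by
    push_cast at hg
    exact (contDiff_succ_iff_deriv.1 hg).2.2
  refine (contDiff_integral_pow_mul_comp n hg' 0 a).contDiffAt.congr_of_eventuallyEq ?_
  filter_upwards [hgf] with t ht
  rcases eq_or_ne t a with rfl | hta
  · simp [hgf.deriv_eq]
  · rw [dslope_of_ne _ hta, slope_def_field, ← ht, ← hgf.eq_of_nhds]
    have hd : ∀ s ∈ Set.uIcc (0 : ℝ) 1, HasDerivAt (fun s => g (a + s * (t - a)))
        ((t - a) * deriv g (a + s * (t - a))) s := fun s _ => by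
      have h2 : HasDerivAt (fun s : ℝ => a + s * (t - a)) (t - a) s := by
        simpa using ((hasDerivAt_id s).mul_const (t - a)).const_add a
      have h3 : HasDerivAt g (deriv g (a + s * (t - a))) (a + s * (t - a)) :=
        (h1.differentiable one_ne_zero _).hasDerivAt
      convert! h3.comp s h2 using 1
      ring
    have hc : Continuous (deriv g) := h1.continuous_deriv le_rfl
    have := intervalIntegral.integral_eq_sub_of_hasDerivAt hd
      (Continuous.intervalIntegrable (by fun_prop) _ _)
    rw [intervalIntegral.integral_const_mul] at this
    have hta' := sub_ne_zero.2 hta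
    simp only [pow_zero, one_mul]
    rw [div_eq_iff hta', mul_comm, this]
    simp

theorem contDiffAt_dslope_of_ne {f : ℝ → ℝ} {a t : ℝ} (hf : ContDiffAt ℝ ∞ f t) (h : t ≠ a) :
    ContDiffAt ℝ ∞ (dslope f a) t := by
  have e : dslope f a =ᶠ[𝓝 t] fun s => (f s - f a) / (s - a) := by
    filter_upwards [isOpen_ne.mem_nhds h] with s hs
    rw [dslope_of_ne _ hs, slope_def_field]
  exact ((hf.sub contDiffAt_const).div (contDiffAt_id.sub contDiffAt_const)
    (sub_ne_zero.2 h)).congr_of_eventuallyEq e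

/-! ### Difference quotients of functions with values in the Grassmann algebra -/

/-- A real function, regarded as a function with values in `ℝ_S`. -/
noncomputable def realFun (φ : ℝ → ℝ) (t : ℝ) : RS := algebraMap ℝ RS (φ t)

/-- The difference quotient `t ↦ (g t - g a) / (t - a)`, with value `g' a` at `a`, of a function
with values in `ℝ_S`. -/
noncomputable def quot (g : ℝ → RS) (a t : ℝ) : RS := ⟨fun l => dslope (fun s => g s l) a t⟩

theorem algebraMap_apply (r : ℝ) (l : Finset ℕ) :
    (algebraMap ℝ RS r) l = if l = ∅ then r else 0 := by
  rw [Algebra.algebraMap_eq_smul_one, smul_apply, one_apply]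
  split_ifs <;> simp

theorem algebraMap_mul_apply (r : ℝ) (z : RS) (l : Finset ℕ) : (algebraMap ℝ RS r * z) l = r * z l := by
  rw [Algebra.algebraMap_eq_smul_one, smul_mul_assoc, one_mul, smul_apply]

theorem SmoothAt.quot {g : ℝ → RS} {a t : ℝ} (ha : SmoothAt g a) (ht : SmoothAt g t) :
    SmoothAt (quot g a) t := fun l => by
  rcases eq_or_ne t a with rfl | h
  · exact contDiffAt_dslope (ha l)
  · exact contDiffAt_dslope_of_ne (ht l) h

theorem eq_const_add_mul_quot (g : ℝ → RS) (a : ℝ) :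
    g = (fun _ => g a) + realFun (fun t => t - a) * quot g a := by
  funext t
  refine ext' fun l => ?_
  have := sub_smul_dslope (fun s => g s l) a t
  simp only [Pi.add_apply, Pi.mul_apply, realFun, add_apply, algebraMap_mul_apply, SuperGeom.quot]
  simp only [smul_eq_mul] at this
  linarith

/-- Multiplication by an element without constant term raises the least length of the multi-indices with
a nonzero coefficient. -/
theorem mul_apply_eq_zero {σ E : RS} {n : ℕ} (hσ : body σ = 0)
    (hE : ∀ m : Finset ℕ, m.card < n → E m = 0) (l : Finset ℕ) (hl : l.card < n + 1) :
    (σ * E) l = 0 := by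
  rw [mul_apply]
  refine Finset.sum_eq_zero fun m hm => ?_
  rcases Finset.eq_empty_or_nonempty m with rfl | hm0
  · have : σ ∅ = 0 := hσ
    simp [this]
  · rw [hE (l \ m), mul_zero]
    have := Finset.card_pos.2 hm0
    rw [Finset.card_sdiff_of_subset (Finset.mem_powerset.1 hm)]
    have := Finset.card_le_card (Finset.mem_powerset.1 hm)
    omega

/-- Since the soul `σ` raises the length of multi-indices, an expression `E g` that satisfies
`E g = σ E h` for some other `h`, for every admissible `g`, vanishes. -/
theorem eq_zero_of_soul_mul {α : Type*} {P : α → Prop} {E : α → RS} {σ : RS} (hσ : body σ = 0)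
    (step : ∀ g, P g → ∃ h, P h ∧ E g = σ * E h) (g : α) (hg : P g) : E g = 0 := by
  have key : ∀ n g, P g → ∀ l : Finset ℕ, l.card < n → E g l = 0 := by
    intro n
    induction n with
    | zero => intro g _ l hl; omega
    | succ n ih =>
      intro g hg l hl
      obtain ⟨h, hh, e⟩ := step g hg
      rw [e]
      exact mul_apply_eq_zero hσ (ih h hh) l hl
  exact ext' fun l => key (l.card + 1) g hg l (Nat.lt_succ_self _)

/-! ### Grassmann analytic continuation, composition and derivatives -/

theorem body_algebraMap (r : ℝ) : body (algebraMap ℝ RS r) = r := by simp [body, algebraMap_apply]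

theorem body_add (a b : RS) : body (a + b) = body a + body b := rfl

theorem body_mul (a b : RS) : body (a * b) = body a * body b := by simp [body, mul_apply]

theorem body_pow (a : RS) (n : ℕ) : body (a ^ n) = body a ^ n := by
  induction n with
  | zero => simp [body, one_apply]
  | succ n ih => rw [pow_succ, pow_succ, body_mul, ih]

theorem body_soul (a : RS) : body (soul a) = 0 := soul_empty a

/-- A real number as a point of `ℝ_S^{1,0}`. -/
noncomputable def real (t : ℝ) : R10 := algebraMap ℝ R10 t

theorem coe_real (t : ℝ) : (real t : RS) = algebraMap ℝ RS t := rfl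

@[simp] theorem body_real (t : ℝ) : body (real t : RS) = t := body_algebraMap t

theorem hat_congr {f g : ℝ → RS} {x : R10} (h : f =ᶠ[𝓝 (body (x : RS))] g) :
    hat f x = hat g x := by
  have : hatTerm f x = hatTerm g x := by
    funext i
    have e : realDeriv i f (body (x : RS)) = realDeriv i g (body (x : RS)) := ext' fun l =>
      EventuallyEq.iteratedDeriv_eq i (h.mono fun t ht => by simp only [ht])
    rw [hatTerm, e, hatTerm]
  rw [hat, this, hat]

theorem realDeriv_zero (f : ℝ → RS) : realDeriv 0 f = f := by
  funext t; exact ext' fun l => by simp [realDeriv]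

theorem body_hat (f : ℝ → RS) (x : R10) : body (hat f x) = body (f (body (x : RS))) := by
  rw [body, hat_apply f x ∅ 1 (by simp)]
  simp [hatTerm, realDeriv_zero, body]

theorem hat_real (f : ℝ → RS) (t : ℝ) : hat f (real t) = f t := by
  have hs : soul (real t : RS) = 0 := by rw [soul, body_real, coe_real, sub_self]
  refine ext' fun l => ?_
  rw [hat_apply f _ l (l.card + 1) (Nat.lt_succ_self _), Finset.sum_eq_single 0]
  · simp [hatTerm, realDeriv_zero]
  · intro i _ hi
    simp [hatTerm, hs, hi]
  · simp

theorem hat_mem_part {e : ZMod 2} {f : ℝ → RS} (hf : ∀ t, f t ∈ part e) (x : R10) :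
    hat f x ∈ part e := by
  intro l hl
  rw [hat_apply f x l _ (Nat.lt_succ_self _)]
  refine (part e).sum_mem (fun i _ => (part e).smul_mem _ ?_) l hl
  have h1 : realDeriv i f (body (x : RS)) ∈ part e := fun m hm => by
    have : (fun s => f s m) = fun _ => 0 := funext fun s => hf s m hm
    simp [realDeriv, this]
  simpa using mul_mem_part h1 (soul_pow_mem x i)

theorem realFun_mem_part (φ : ℝ → ℝ) (t : ℝ) : realFun φ t ∈ part 0 := evenSubalgebra.algebraMap_mem _

theorem smoothAt_realFun {φ : ℝ → ℝ} {t : ℝ} (h : ContDiffAt ℝ ∞ φ t) : SmoothAt (realFun φ) t := by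
  intro l
  simp only [realFun, algebraMap_apply]
  split_ifs
  · exact h
  · exact contDiffAt_const

theorem realDeriv_realFun (n : ℕ) (φ : ℝ → ℝ) :
    realDeriv n (realFun φ) = realFun (iteratedDeriv n φ) := by
  funext t
  refine ext' fun l => ?_
  simp only [realDeriv, realFun, algebraMap_apply]
  split_ifs <;> simp

theorem realFun_mul (φ ψ : ℝ → ℝ) : realFun (φ * ψ) = realFun φ * realFun ψ := by
  funext t; simp [realFun]

theorem realFun_add (φ ψ : ℝ → ℝ) : realFun (φ + ψ) = realFun φ + realFun ψ := by
  funext t; simp [realFun]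

theorem realFun_const (c : ℝ) : realFun (fun _ => c) = fun _ => algebraMap ℝ RS c := rfl

theorem hat_realFun_id (x : R10) : hat (realFun fun t => t) x = x := by
  refine ext' fun l => ?_
  rw [hat_apply _ x l (l.card + 2) (by omega), Finset.sum_range_succ', Finset.sum_range_succ',
    Finset.sum_eq_zero]
  · have h1 : realDeriv 1 (realFun fun t => t) (body (x : RS)) = 1 := by
      simp [realDeriv_realFun, realFun]
    simp only [hatTerm, h1, zero_add, realDeriv_zero, realFun, soul]
    simp
  · intro i _
    have : iteratedDeriv (i + 1 + 1) (fun t : ℝ => t) = fun _ => 0 := by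
      rw [iteratedDeriv_succ', iteratedDeriv_succ']
      funext s
      simp
    simp [hatTerm, realDeriv_realFun, this, realFun]

theorem hat_realFun_add_const {φ : ℝ → ℝ} {x : R10} (hφ : ContDiffAt ℝ ∞ φ (body (x : RS))) (c : ℝ) :
    hat (realFun fun t => φ t + c) x = hat (realFun φ) x + algebraMap ℝ RS c := by
  have : (realFun fun t => φ t + c) = realFun φ + fun _ => algebraMap ℝ RS c := realFun_add φ fun _ => c
  rw [this, hat_add (smoothAt_realFun hφ) (SmoothAt.const _ _), hat_const]

theorem hat_neg {f : ℝ → RS} {x : R10} (hf : SmoothAt f (body (x : RS))) :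
    hat (-f) x = -hat f x := by
  have : -f = (fun _ => -1) * f := by funext t; simp
  rw [this, hat_mul (SmoothAt.const _ _) hf, hat_const, neg_one_mul]

/-- The Grassmann analytic continuation of a real function, with values in `ℝ_S^{1,0}`. -/
noncomputable def evenHat (φ : ℝ → ℝ) (x : R10) : R10 :=
  ⟨hat (realFun φ) x, hat_mem_part (realFun_mem_part φ) x⟩

theorem coe_evenHat (φ : ℝ → ℝ) (x : R10) : (evenHat φ x : RS) = hat (realFun φ) x := rfl

@[simp] theorem body_evenHat (φ : ℝ → ℝ) (x : R10) : body (evenHat φ x : RS) = φ (body (x : RS)) := by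
  rw [coe_evenHat, body_hat, realFun, body_algebraMap]

theorem evenHat_real (φ : ℝ → ℝ) (t : ℝ) : evenHat φ (real t) = real (φ t) :=
  Subtype.ext (hat_real _ _)

theorem evenHat_id (x : R10) : evenHat (fun t => t) x = x := Subtype.ext (hat_realFun_id x)

theorem evenHat_congr {φ ψ : ℝ → ℝ} {x : R10} (h : φ =ᶠ[𝓝 (body (x : RS))] ψ) :
    evenHat φ x = evenHat ψ x :=
  Subtype.ext (hat_congr (h.mono fun t ht => by simp only [realFun, ht]))

theorem SmoothAt.comp {g : ℝ → RS} {φ : ℝ → ℝ} {t : ℝ} (hg : SmoothAt g (φ t))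
    (hφ : ContDiffAt ℝ ∞ φ t) : SmoothAt (fun s => g (φ s)) t := fun l =>
  ContDiffAt.comp t (hg l) hφ

/-- Hadamard's lemma for Grassmann analytic continuations. -/
theorem hat_eq_add_mul_hat_quot {g : ℝ → RS} {a : ℝ} {x : R10} (ha : SmoothAt g a)
    (hx : SmoothAt g (body (x : RS))) :
    hat g x = g a + (x - algebraMap ℝ RS a) * hat (quot g a) x := by
  have hl : ContDiffAt ℝ ∞ (fun t : ℝ => t - a) (body (x : RS)) := contDiffAt_id.sub contDiffAt_const
  conv_lhs => rw [eq_const_add_mul_quot g a]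
  rw [hat_add (SmoothAt.const _ _) ((smoothAt_realFun hl).mul (ha.quot hx)), hat_const,
    hat_mul (smoothAt_realFun hl) (ha.quot hx)]
  simp only [sub_eq_add_neg]
  rw [hat_realFun_add_const (φ := fun t => t) contDiffAt_id, hat_realFun_id, map_neg]

/-- Grassmann analytic continuation commutes with composition. -/
theorem hat_comp {g : ℝ → RS} {φ : ℝ → ℝ} {x : R10} (hφ : ContDiffAt ℝ ∞ φ (body (x : RS)))
    (hg : SmoothAt g (φ (body (x : RS)))) :
    hat (fun t => g (φ t)) x = hat g (evenHat φ x) := by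
  set y := evenHat φ x with hy
  set a := φ (body (x : RS)) with ha
  have hya : body (y : RS) = a := body_evenHat φ x
  refine sub_eq_zero.1 (eq_zero_of_soul_mul (P := fun g => SmoothAt g a)
    (E := fun g => hat (fun t => g (φ t)) x - hat g y) (body_soul (y : RS)) (fun g hg => ?_) g hg)
  refine ⟨quot g a, hg.quot hg, ?_⟩
  have hl : ContDiffAt ℝ ∞ (fun t => φ t + -a) (body (x : RS)) := hφ.add contDiffAt_const
  have e : (fun t => g (φ t)) =
      (fun _ => g a) + realFun (fun t => φ t + -a) * fun t => quot g a (φ t) := by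
    funext t
    exact congrFun (eq_const_add_mul_quot g a) (φ t)
  have hq := (hg.quot hg).comp hφ
  rw [hat_eq_add_mul_hat_quot (x := y) hg (by rwa [hya]), e,
    hat_add (SmoothAt.const _ _) ((smoothAt_realFun hl).mul hq), hat_const,
    hat_mul (smoothAt_realFun hl) hq, hat_realFun_add_const hφ, ← coe_evenHat, ← hy, soul, hya,
    map_neg, ← sub_eq_add_neg, mul_sub]
  abel

theorem evenHat_comp {φ ψ : ℝ → ℝ} {x : R10} (hφ : ContDiffAt ℝ ∞ φ (body (x : RS)))
    (hψ : ContDiffAt ℝ ∞ ψ (φ (body (x : RS)))) :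
    evenHat (fun t => ψ (φ t)) x = evenHat ψ (evenHat φ x) :=
  Subtype.ext (hat_comp (g := realFun ψ) hφ (smoothAt_realFun hψ))

theorem SmoothAt.realDeriv_one {g : ℝ → RS} {t : ℝ} (hg : SmoothAt g t) :
    SmoothAt (realDeriv 1 g) t := fun l => by
  simp only [realDeriv, iteratedDeriv_one]
  exact (hg l).derivWithin  (by simp)

theorem realDeriv_one_mul {f g : ℝ → RS} {t : ℝ} (hf : SmoothAt f t) (hg : SmoothAt g t) :
    realDeriv 1 (f * g) t = realDeriv 1 f t * g t + f t * realDeriv 1 g t := by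
  rw [realDeriv_mul hf hg]
  simp [Finset.sum_range_succ, realDeriv_zero, add_comm]

theorem realDeriv_one_const (c : RS) (t : ℝ) : realDeriv 1 (fun _ => c) t = 0 :=
  ext' fun l => by simp [realDeriv]

theorem hat_realDeriv_mul {f g : ℝ → RS} {x : R10} (hf : ∀ᶠ t in 𝓝 (body (x : RS)), SmoothAt f t)
    (hg : ∀ᶠ t in 𝓝 (body (x : RS)), SmoothAt g t) :
    hat (realDeriv 1 (f * g)) x =
      hat (realDeriv 1 f) x * hat g x + hat f x * hat (realDeriv 1 g) x := by
  have hf' := hf.self_of_nhds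
  have hg' := hg.self_of_nhds
  rw [← hat_mul hf'.realDeriv_one hg', ← hat_mul hf' hg'.realDeriv_one,
    ← hat_add (hf'.realDeriv_one.mul hg') (hf'.mul hg'.realDeriv_one)]
  refine hat_congr ?_
  filter_upwards [hf, hg] with t h1 h2
  exact realDeriv_one_mul h1 h2

theorem hat_realDeriv_add {f g : ℝ → RS} {x : R10} (hf : ∀ᶠ t in 𝓝 (body (x : RS)), SmoothAt f t)
    (hg : ∀ᶠ t in 𝓝 (body (x : RS)), SmoothAt g t) :
    hat (realDeriv 1 (f + g)) x = hat (realDeriv 1 f) x + hat (realDeriv 1 g) x := by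
  rw [← hat_add hf.self_of_nhds.realDeriv_one hg.self_of_nhds.realDeriv_one]
  refine hat_congr ?_
  filter_upwards [hf, hg] with t h1 h2
  exact realDeriv_add h1 h2 1

theorem hat_realDeriv_const (c : RS) (x : R10) : hat (realDeriv 1 fun _ => c) x = 0 := by
  rw [funext (realDeriv_one_const c), hat_const]

theorem hat_realDeriv_mem_part {e : ZMod 2} {f : ℝ → RS} (hf : ∀ t, f t ∈ part e) (x : R10) :
    hat (realDeriv 1 f) x ∈ part e := by
  refine hat_mem_part (fun t m hm => ?_) x
  have : (fun s => f s m) = fun _ => 0 := funext fun s => hf s m hm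
  simp [realDeriv, this]

/-- The derivative of the factorization of `hat_eq_add_mul_hat_quot` at the body of `x`. -/
theorem hat_realDeriv_eq {g : ℝ → RS} {x : R10}
    (hg : ∀ᶠ t in 𝓝 (body (x : RS)), SmoothAt g t) :
    hat (realDeriv 1 g) x = hat (quot g (body (x : RS))) x +
      soul (x : RS) * hat (realDeriv 1 (quot g (body (x : RS)))) x := by
  set a := body (x : RS) with ha
  have hl : ∀ t, ContDiffAt ℝ ∞ (fun t : ℝ => t + -a) t := fun t => contDiffAt_id.add contDiffAt_const
  have hq : ∀ᶠ t in 𝓝 a, SmoothAt (quot g a) t := hg.mono fun t ht => hg.self_of_nhds.quot ht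
  have hl' : ∀ᶠ t in 𝓝 a, SmoothAt (realFun fun t => t + -a) t :=
    .of_forall fun t => smoothAt_realFun (hl t)
  conv_lhs => rw [eq_const_add_mul_quot g a]
  simp only [sub_eq_add_neg]
  rw [hat_realDeriv_add (.of_forall fun t => SmoothAt.const _ t)
      (by filter_upwards [hl', hq] with t h1 h2 using h1.mul h2), hat_realDeriv_const, zero_add,
    hat_realDeriv_mul hl' hq, hat_realFun_add_const (φ := fun t => t) contDiffAt_id, hat_realFun_id, map_neg,
    ← sub_eq_add_neg, realDeriv_realFun]
  have : iteratedDeriv 1 (fun t : ℝ => t + -a) = fun _ => 1 := by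
    funext t
    simp [iteratedDeriv_one]
  rw [this, realFun_const, hat_const, map_one, one_mul]
  rfl

/-! ### The super sine and cosine -/

/-- The binomial expansion of `(ε(x) + σ(x)) ^ m`; powers of the soul beyond the length of `l` do not
contribute to the coefficient at `l`. -/
theorem pow_apply (x : R10) (m : ℕ) (l : Finset ℕ) :
    ((x : RS) ^ m) l = ∑ k ∈ Finset.range (l.card + 1),
      (m.choose k : ℝ) * body (x : RS) ^ (m - k) * (soul (x : RS) ^ k) l := by
  set N := l.card + 1
  have hx : (x : RS) = soul (x : RS) + algebraMap ℝ RS (body (x : RS)) := by simp [soul]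
  have hk : ∀ k, (soul (x : RS) ^ k * algebraMap ℝ RS (body (x : RS)) ^ (m - k) * (m.choose k : RS)) l =
      (m.choose k : ℝ) * body (x : RS) ^ (m - k) * (soul (x : RS) ^ k) l := by
    intro k
    rw [← map_pow, ← map_natCast (algebraMap ℝ RS), mul_assoc, ← map_mul, mul_comm (_ ^ (m - k)),
      ← Algebra.commutes, algebraMap_mul_apply]
  conv_lhs => rw [hx]
  rw [(Algebra.commute_algebraMap_right (body (x : RS)) (soul (x : RS))).add_pow, RS.sum_apply]
  simp only [hk]
  rw [Finset.sum_subset (Finset.range_mono (le_max_left (m + 1) N)),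
    Finset.sum_subset (Finset.range_mono (le_max_right (m + 1) N))]
  · intro k _ hk
    have := mul_soul_pow_eq_zero (x : RS) k 1 l (by simp [N] at hk; omega)
    rw [one_mul] at this
    rw [this, mul_zero]
  · intro k _ hk
    rw [Nat.choose_eq_zero_of_lt (by simpa using hk)]
    simp

/-- `φ` is the sum of its Taylor series at `0` on the whole real line. -/
def HasTaylorSum (φ : ℝ → ℝ) : Prop :=
  ∀ t, HasSum (fun m : ℕ => iteratedDeriv m φ 0 / (m.factorial : ℝ) * t ^ m) (φ t)

theorem iteratedDeriv_iteratedDeriv (m k : ℕ) (φ : ℝ → ℝ) :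
    iteratedDeriv m (iteratedDeriv k φ) = iteratedDeriv (m + k) φ := by
  rw [iteratedDeriv_eq_iterate, iteratedDeriv_eq_iterate, iteratedDeriv_eq_iterate,
    Function.iterate_add_apply]

/-- If all derivatives of `φ` are sums of their Taylor series, then the Grassmann analytic continuation
of `φ` is the sum of the Taylor series of `φ` at `0`, coefficient by coefficient. -/
theorem hasSum_taylor_hat {φ : ℝ → ℝ} (h : ∀ k, HasTaylorSum (iteratedDeriv k φ)) (x : R10)
    (l : Finset ℕ) :
    HasSum (fun m : ℕ => iteratedDeriv m φ 0 / (m.factorial : ℝ) * ((x : RS) ^ m) l)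
      (hat (realFun φ) x l) := by
  set t := body (x : RS) with ht
  have key : ∀ k, HasSum (fun m : ℕ => iteratedDeriv m φ 0 / (m.factorial : ℝ) *
      ((m.choose k : ℝ) * t ^ (m - k))) (1 / (k.factorial : ℝ) * iteratedDeriv k φ t) := by
    intro k
    rw [← (add_left_injective k).hasSum_iff]
    · convert! (h k t).mul_left (1 / (k.factorial : ℝ)) using 2 with m
      simp only [Function.comp_apply, Nat.add_sub_cancel, iteratedDeriv_iteratedDeriv]
      rw [Nat.cast_choose ℝ (Nat.le_add_left k m), Nat.add_sub_cancel]
      have h1 := Nat.factorial_ne_zero (m + k)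
      field_simp
    · intro m hm
      have : m < k := by
        by_contra hmk
        exact hm ⟨m - k, Nat.sub_add_cancel (not_lt.1 hmk)⟩
      simp [Nat.choose_eq_zero_of_lt this]
  rw [hat_apply _ x l _ (Nat.lt_succ_self _), RS.sum_apply]
  have := hasSum_sum (s := Finset.range (l.card + 1)) fun k _ =>
    (key k).mul_right ((soul (x : RS) ^ k) l)
  convert! this using 1
  · funext m
    rw [pow_apply, Finset.mul_sum]
    exact Finset.sum_congr rfl fun k _ => by ring
  · refine Finset.sum_congr rfl fun k _ => ?_
    rw [hatTerm, realDeriv_realFun, realFun, smul_apply, algebraMap_mul_apply, mul_assoc]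

theorem hasSum_taylor_sin_iff (a : ℕ → ℝ) (s : ℝ) :
    HasSum (fun m : ℕ => iteratedDeriv m Real.sin 0 / (m.factorial : ℝ) * a m) s ↔
      HasSum (fun i : ℕ => (-1) ^ i / ((2 * i + 1).factorial : ℝ) * a (2 * i + 1)) s := by
  have hinj : Function.Injective fun i : ℕ => 2 * i + 1 := fun i j h => by simpa using h
  rw [← hinj.hasSum_iff]
  · simp [Function.comp_def]
  · intro m hm
    obtain ⟨i, rfl | rfl⟩ := m.even_or_odd'
    · simp [Real.iteratedDeriv_even_sin]
    · exact absurd ⟨i, rfl⟩ hm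

theorem hasSum_taylor_cos_iff (a : ℕ → ℝ) (s : ℝ) :
    HasSum (fun m : ℕ => iteratedDeriv m Real.cos 0 / (m.factorial : ℝ) * a m) s ↔
      HasSum (fun i : ℕ => (-1) ^ i / ((2 * i).factorial : ℝ) * a (2 * i)) s := by
  have hinj : Function.Injective fun i : ℕ => 2 * i := fun i j h => by simpa using h
  rw [← hinj.hasSum_iff]
  · simp [Function.comp_def, Real.iteratedDeriv_even_cos]
  · intro m hm
    obtain ⟨i, rfl | rfl⟩ := m.even_or_odd'
    · exact absurd ⟨i, rfl⟩ hm
    · simp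

theorem HasTaylorSum.neg {φ : ℝ → ℝ} (h : HasTaylorSum φ) : HasTaylorSum (-φ) := fun t => by
  simpa [iteratedDeriv_neg, neg_div] using (h t).neg

theorem hasTaylorSum_iteratedDeriv_sin_cos (k : ℕ) :
    HasTaylorSum (iteratedDeriv k Real.sin) ∧ HasTaylorSum (iteratedDeriv k Real.cos) := by
  induction k with
  | zero =>
    simp only [iteratedDeriv_zero]
    refine ⟨fun t => (hasSum_taylor_sin_iff _ _).2 ?_, fun t => (hasSum_taylor_cos_iff _ _).2 ?_⟩
    · simpa only [div_mul_eq_mul_div] using Real.hasSum_sin t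
    · simpa only [div_mul_eq_mul_div] using Real.hasSum_cos t
  | succ k ih =>
    rw [Real.iteratedDeriv_add_one_sin, Real.iteratedDeriv_add_one_cos]
    exact ⟨ih.2, ih.1.neg⟩

theorem hasSum_sinTerm (θ : R10) (l : Finset ℕ) :
    HasSum (fun i => sinTerm θ i l) (hat (realFun Real.sin) θ l) :=
  (hasSum_taylor_sin_iff (fun m => ((θ : RS) ^ m) l) _).1
    (hasSum_taylor_hat (fun k => (hasTaylorSum_iteratedDeriv_sin_cos k).1) θ l)

theorem hasSum_cosTerm (θ : R10) (l : Finset ℕ) :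
    HasSum (fun i => cosTerm θ i l) (hat (realFun Real.cos) θ l) :=
  (hasSum_taylor_cos_iff (fun m => ((θ : RS) ^ m) l) _).1
    (hasSum_taylor_hat (fun k => (hasTaylorSum_iteratedDeriv_sin_cos k).2) θ l)

theorem sinBar_eq_hat (θ : R10) : sinBar θ = hat (realFun Real.sin) θ :=
  ext' fun l => (hasSum_sinTerm θ l).tsum_eq

theorem cosBar_eq_hat (θ : R10) : cosBar θ = hat (realFun Real.cos) θ :=
  ext' fun l => (hasSum_cosTerm θ l).tsum_eq

theorem smoothAt_realFun_sin (t : ℝ) : SmoothAt (realFun Real.sin) t :=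
  smoothAt_realFun Real.contDiff_sin.contDiffAt

theorem smoothAt_realFun_cos (t : ℝ) : SmoothAt (realFun Real.cos) t :=
  smoothAt_realFun Real.contDiff_cos.contDiffAt

theorem realDeriv_realFun_sin : realDeriv 1 (realFun Real.sin) = realFun Real.cos := by
  rw [realDeriv_realFun, iteratedDeriv_one, Real.deriv_sin]

theorem realDeriv_realFun_cos : realDeriv 1 (realFun Real.cos) = -realFun Real.sin := by
  rw [realDeriv_realFun, iteratedDeriv_one, Real.deriv_cos']
  funext t
  simp [realFun]

theorem hasSuperDerivOn_sinBar : HasSuperDerivOn Set.univ sinBar cosBar :=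
  ⟨realFun Real.sin, fun _ _ => smoothAt_realFun_sin _, fun θ _ => sinBar_eq_hat θ, fun θ _ => by
    rw [realDeriv_realFun_sin, cosBar_eq_hat]⟩

theorem hasSuperDerivOn_cosBar : HasSuperDerivOn Set.univ cosBar fun θ => -sinBar θ :=
  ⟨realFun Real.cos, fun _ _ => smoothAt_realFun_cos _, fun θ _ => cosBar_eq_hat θ, fun θ _ => by
    simp only [realDeriv_realFun_cos, sinBar_eq_hat, hat_neg (smoothAt_realFun_sin _)]⟩

theorem evenHat_cos_sq_add_evenHat_sin_sq (θ : R10) :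
    evenHat Real.cos θ ^ 2 + evenHat Real.sin θ ^ 2 = 1 := by
  refine Subtype.ext ?_
  have e : (realFun Real.cos * realFun Real.cos) + (realFun Real.sin * realFun Real.sin) =
      fun _ => 1 := by
    rw [← realFun_mul, ← realFun_mul, ← realFun_add]
    funext t
    have := Real.cos_sq_add_sin_sq t
    simp only [Pi.add_apply, Pi.mul_apply, realFun, ← sq (Real.cos t), ← sq (Real.sin t), this, map_one]
  have hs := smoothAt_realFun_sin (body (θ : RS))
  have hc := smoothAt_realFun_cos (body (θ : RS))
  change (hat _ θ) ^ 2 + (hat _ θ) ^ 2 = 1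
  rw [pow_two, pow_two, ← hat_mul hc hc, ← hat_mul hs hs, ← hat_add (hc.mul hc) (hs.mul hs), e,
    hat_const]

/-! ### Locality of superderivations -/

section Derivation

variable {X : Type} {C : ChartData X} {p : X} {d : ZMod 2} {D : gInftyAt C p → RS}

theorem GInftyOn.congr {W : Set X} {u v : X → RS} (hu : GInftyOn C W u) (h : Set.EqOn u v W) :
    GInftyOn C W v := fun i => by
  obtain ⟨f, hf, hfu⟩ := hu i
  exact ⟨f, hf, fun q hq => by rw [← h hq.1, hfu q hq]⟩

theorem koszul_zero_right (d : ZMod 2) : koszul d 0 = 1 := by simp [koszul]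

theorem IsSuperDerivation.leibniz_even (hD : IsSuperDerivation C p d D) (u v : gInftyAt C p)
    (hu : ∀ q, (u : X → RS) q ∈ part 0) :
    D (u * v) = D u * (v : X → RS) p + (u : X → RS) p * D v := by
  rw [hD.leibniz 0 u v hu, koszul_zero_right, one_smul]

theorem IsSuperDerivation.map_const (hD : IsSuperDerivation C p d D) (c : RS) :
    D (constAt C p c) = 0 := by
  have h1 : D 1 = 0 := by
    have := hD.leibniz_even 1 1 fun _ => one_mem_part
    simpa using this
  have := hD.map_mul_const 1 c
  rwa [one_mul, h1, zero_mul] at this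

/-- Superderivations are local: multiply the difference `u - v` by a function that vanishes near `p`
and equals `1` where the difference does not vanish. -/
theorem IsSuperDerivation.congr (hD : IsSuperDerivation C p d D) {u v : gInftyAt C p} {W : Set X}
    (hW : IsOpenIn C W) (hp : p ∈ W) (h : Set.EqOn (u : X → RS) (v : X → RS) W) : D u = D v := by
  classical
  let χ : gInftyAt C p := ⟨fun q => if q ∈ W then 0 else 1, W, hW, hp,
    (GInftyOn.const C W 0).congr fun q hq => by simp [hq]⟩
  have hχ : ∀ q, (χ : X → RS) q ∈ part 0 := fun q => by
    by_cases hq : q ∈ W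
    · simp [χ, hq]
    · simpa [χ, hq] using one_mem_part
  have hw : χ * (u - v) = u - v := by
    refine Subtype.ext (funext fun q => ?_)
    by_cases hq : q ∈ W
    · simp [χ, hq, h hq]
    · simp [χ, hq]
  have h0 : D (u - v) = 0 := by
    have := hD.leibniz_even χ (u - v) hχ
    rw [hw] at this
    rw [this]
    simp [χ, hp, h hp]
  rw [← sub_add_cancel u v, hD.map_add, h0, zero_add]

end Derivation

/-! ### Charts and angles on the supercircle -/

/-- An even element is determined by its square and the sign of its body, if the latter is not `0`. -/
theorem eq_of_sq_eq_sq {a b : R10} (h : a ^ 2 = b ^ 2) (hab : body (a : RS) + body (b : RS) ≠ 0) :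
    a = b := by
  refine Subtype.ext (sub_eq_zero.1 ?_)
  set r := body (a : RS) + body (b : RS) with hr
  have h2 : (a : RS) * a = b * b := by simpa [pow_two] using congrArg Subtype.val h
  -- With `c = a + b` of body `r ≠ 0`, the equation `c (a - b) = 0` says `a - b = -(σ(c) / r) (a - b)`.
  have hc : ((a : RS) + b) * (a - b) = 0 := by
    rw [add_mul, mul_sub, mul_sub, h2, even_comm a.2 (b : RS)]
    abel
  have hσ : body (-((1 / r) • soul ((a : RS) + b))) = 0 := by
    have : body (soul ((a : RS) + b)) = 0 := body_soul _
    simp only [body] at this ⊢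
    simp [this]
  refine eq_zero_of_soul_mul (α := Unit) (P := fun _ => True) (E := fun _ => (a : RS) - b) hσ
    (fun _ _ => ⟨(), trivial, ?_⟩) () trivial
  have hs : soul ((a : RS) + b) = (a + b) - algebraMap ℝ RS r := by rw [soul, body_add]
  rw [hs, smul_sub, neg_sub, sub_mul, smul_mul_assoc, smul_mul_assoc, hc, smul_zero, sub_zero,
    Algebra.algebraMap_eq_smul_one, smul_mul_assoc, one_mul, smul_smul, one_div_mul_cancel hab,
    one_smul]

namespace Supercircle

/-- The parametrization `θ ↦ (cos θ, sin θ)` of the supercircle. -/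
noncomputable def angle (θ : R10) : Supercircle :=
  ⟨(evenHat Real.cos θ, evenHat Real.sin θ), evenHat_cos_sq_add_evenHat_sin_sq θ⟩

theorem angle_x (θ : R10) : (angle θ).x = evenHat Real.cos θ := rfl

theorem angle_y (θ : R10) : (angle θ).y = evenHat Real.sin θ := rfl

/-- The body of a point of the supercircle, a point of the unit circle. -/
noncomputable def bodyPt (p : Supercircle) : ℝ × ℝ := (body (p.x : RS), body (p.y : RS))

/-- The standard parametrization of the unit circle. -/
noncomputable def circ (t : ℝ) : ℝ × ℝ := (Real.cos t, Real.sin t)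

theorem continuous_circ : Continuous circ := by unfold circ; fun_prop

theorem bodyPt_angle (θ : R10) : bodyPt (angle θ) = circ (body (θ : RS)) := by
  simp [bodyPt, angle_x, angle_y, circ]

theorem bodyPt_sq (p : Supercircle) : (bodyPt p).1 ^ 2 + (bodyPt p).2 ^ 2 = 1 := by
  have := congrArg (fun a : R10 => body (a : RS)) p.2
  simpa [bodyPt, x, y, body_add, body_pow, show body 1 = 1 from rfl] using this

/-- The part of the plane in which the body of a point of the domain of a chart lies. -/
def Chart.side : Chart → Set (ℝ × ℝ)
  | .xpos => {q | 0 < q.1}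
  | .xneg => {q | q.1 < 0}
  | .ypos => {q | 0 < q.2}
  | .yneg => {q | q.2 < 0}

/-- The angle of a point in the domain of a chart, as a function of the coordinate. -/
noncomputable def Chart.branch : Chart → ℝ → ℝ
  | .xpos => Real.arcsin
  | .xneg => fun t => Real.pi - Real.arcsin t
  | .ypos => Real.arccos
  | .yneg => fun t => -Real.arccos t

/-- The coordinate of a chart, as a function of the angle. -/
noncomputable def Chart.trig : Chart → ℝ → ℝ
  | .xpos => Real.sin
  | .xneg => Real.sin
  | .ypos => Real.cos
  | .yneg => Real.cos

/-- The domain of a chart. -/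
def Chart.dom (i : Chart) : Set Supercircle := charts.dom i

/-- The coordinate map of a chart. -/
def Chart.coord (i : Chart) : Supercircle → R10 := charts.map i

theorem isOpenIn_iff {W : Set Supercircle} : IsOpenIn charts W ↔ ∀ i : Chart, ∃ O : Set R10,
    IsDeWittOpen O ∧ W ∩ i.dom = i.coord ⁻¹' O ∩ i.dom := Iff.rfl

theorem gInftyOn_iff {W : Set Supercircle} {u : Supercircle → RS} : GInftyOn charts W u ↔
    ∀ i : Chart, ∃ f : R10 → RS, IsGInftyOn (i.coord '' (W ∩ i.dom)) f ∧
      ∀ p ∈ W ∩ i.dom, u p = f (i.coord p) := Iff.rfl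

theorem Chart.isOpen_side (i : Chart) : IsOpen i.side := by
  cases i
  · exact isOpen_lt continuous_const continuous_fst
  · exact isOpen_lt continuous_fst continuous_const
  · exact isOpen_lt continuous_const continuous_snd
  · exact isOpen_lt continuous_snd continuous_const

theorem Chart.continuous_branch (i : Chart) : Continuous i.branch := by
  cases i
  · exact Real.continuous_arcsin
  · exact continuous_const.sub Real.continuous_arcsin
  · exact Real.continuous_arccos
  · exact Real.continuous_arccos.neg

theorem Chart.contDiffAt_branch (i : Chart) {t : ℝ} (ht : t ∈ Set.Ioo (-1 : ℝ) 1) :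
    ContDiffAt ℝ ∞ i.branch t := by
  have h1 := Real.contDiffAt_arcsin (n := ∞) ht.1.ne' ht.2.ne
  have h2 := Real.contDiffAt_arccos (n := ∞) ht.1.ne' ht.2.ne
  cases i
  · exact h1
  · exact contDiffAt_const.sub h1
  · exact h2
  · exact h2.neg

theorem Chart.contDiff_trig (i : Chart) : ContDiff ℝ ∞ i.trig := by
  cases i
  · exact Real.contDiff_sin
  · exact Real.contDiff_sin
  · exact Real.contDiff_cos
  · exact Real.contDiff_cos

theorem Chart.trig_branch (i : Chart) {t : ℝ} (ht : t ∈ Set.Ioo (-1 : ℝ) 1) :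
    i.trig (i.branch t) = t := by
  have h1 := Real.sin_arcsin ht.1.le ht.2.le
  have h2 := Real.cos_arccos ht.1.le ht.2.le
  cases i
  · exact h1
  · exact (Real.sin_pi_sub _).trans h1
  · exact h2
  · exact (Real.cos_neg _).trans h2

theorem Chart.circ_branch_mem (i : Chart) {t : ℝ} (ht : t ∈ Set.Ioo (-1 : ℝ) 1) :
    circ (i.branch t) ∈ i.side := by
  have h : 0 < √(1 - t ^ 2) := Real.sqrt_pos.2 (by nlinarith [ht.1, ht.2])
  cases i
  · simpa [circ, branch, side, Real.cos_arcsin] using h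
  · simpa [circ, branch, side, Real.cos_arcsin, Real.cos_pi_sub] using h
  · simpa [circ, branch, side, Real.sin_arccos] using h
  · simpa [circ, branch, side, Real.sin_arccos] using h

theorem mem_dom_iff (i : Chart) (p : Supercircle) : p ∈ i.dom ↔ bodyPt p ∈ i.side := by
  cases i <;> rfl

theorem coord_angle (i : Chart) (θ : R10) : i.coord (angle θ) = evenHat i.trig θ := by
  cases i <;> rfl

theorem exists_mem_dom (p : Supercircle) : ∃ i : Chart, p ∈ Chart.dom i := by
  have h := bodyPt_sq p
  simp only [mem_dom_iff]
  rcases lt_trichotomy (bodyPt p).1 0 with h1 | h1 | h1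
  · exact ⟨.xneg, h1⟩
  · rcases lt_trichotomy (bodyPt p).2 0 with h2 | h2 | h2
    · exact ⟨.yneg, h2⟩
    · simp [h1, h2] at h
    · exact ⟨.ypos, h2⟩
  · exact ⟨.xpos, h1⟩

theorem ext_xy {p q : Supercircle} (hx : p.x = q.x) (hy : p.y = q.y) : p = q :=
  Subtype.ext (Prod.ext hx hy)

theorem injOn_coord (i : Chart) : Set.InjOn i.coord i.dom := by
  intro p hp q hq h
  have e : p.x ^ 2 + p.y ^ 2 = q.x ^ 2 + q.y ^ 2 := p.2.trans q.2.symm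
  cases i
  · replace h : p.y = q.y := h
    rw [h] at e
    exact ext_xy (eq_of_sq_eq_sq (add_right_cancel e) (add_pos hp hq).ne') h
  · replace h : p.y = q.y := h
    rw [h] at e
    exact ext_xy (eq_of_sq_eq_sq (add_right_cancel e) (add_neg hp hq).ne) h
  · replace h : p.x = q.x := h
    rw [h] at e
    exact ext_xy h (eq_of_sq_eq_sq (add_left_cancel e) (add_pos hp hq).ne')
  · replace h : p.x = q.x := h
    rw [h] at e
    exact ext_xy h (eq_of_sq_eq_sq (add_left_cancel e) (add_neg hp hq).ne)

theorem body_coord_mem {i : Chart} {p : Supercircle} (hp : p ∈ i.dom) :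
    body (i.coord p : RS) ∈ Set.Ioo (-1 : ℝ) 1 := by
  have h := bodyPt_sq p
  rw [Set.mem_Ioo, ← abs_lt, ← sq_lt_one_iff_abs_lt_one]
  cases i
  · have : 0 < (bodyPt p).1 := hp
    change (bodyPt p).2 ^ 2 < 1
    nlinarith
  · have : (bodyPt p).1 < 0 := hp
    change (bodyPt p).2 ^ 2 < 1
    nlinarith
  · have : 0 < (bodyPt p).2 := hp
    change (bodyPt p).1 ^ 2 < 1
    nlinarith
  · have : (bodyPt p).2 < 0 := hp
    change (bodyPt p).1 ^ 2 < 1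
    nlinarith

theorem angle_branch_mem (i : Chart) {s : R10} (hs : body (s : RS) ∈ Set.Ioo (-1 : ℝ) 1) :
    angle (evenHat i.branch s) ∈ Chart.dom i := by
  rw [mem_dom_iff, bodyPt_angle, body_evenHat]
  exact i.circ_branch_mem hs

theorem coord_angle_branch (i : Chart) {s : R10} (hs : body (s : RS) ∈ Set.Ioo (-1 : ℝ) 1) :
    i.coord (angle (evenHat i.branch s)) = s := by
  rw [coord_angle, ← evenHat_comp (i.contDiffAt_branch hs) i.contDiff_trig.contDiffAt]
  conv_rhs => rw [← evenHat_id s]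
  refine evenHat_congr ?_
  filter_upwards [isOpen_Ioo.mem_nhds hs] with t ht using i.trig_branch ht

/-- The inverse of a chart is given by the angle. -/
theorem angle_branch_coord {i : Chart} {p : Supercircle} (hp : p ∈ i.dom) :
    angle (evenHat i.branch (i.coord p)) = p :=
  injOn_coord i (angle_branch_mem i (body_coord_mem hp)) hp (coord_angle_branch i (body_coord_mem hp))

theorem angle_surjective : Function.Surjective angle := fun p =>
  let ⟨_, hi⟩ := exists_mem_dom p
  ⟨_, angle_branch_coord hi⟩

theorem bodyPt_eq {i : Chart} {p : Supercircle} (hp : p ∈ i.dom) :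
    bodyPt p = circ (i.branch (body (i.coord p : RS))) := by
  conv_lhs => rw [← angle_branch_coord hp, bodyPt_angle, body_evenHat]

theorem isOpenIn_bodyPt {B : Set (ℝ × ℝ)} (hB : IsOpen B) : IsOpenIn charts (bodyPt ⁻¹' B) := by
  refine isOpenIn_iff.2 fun i => ?_
  refine ⟨_, ⟨_, hB.preimage (continuous_circ.comp i.continuous_branch), rfl⟩, ?_⟩
  ext p
  simp only [Set.mem_inter_iff, Set.mem_preimage, Set.mem_ofPred_eq]
  refine and_congr_left fun hp => ?_
  rw [bodyPt_eq hp]; rfl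

theorem isDeWittOpen_image (i : Chart) {B : Set (ℝ × ℝ)} (hB : IsOpen B) :
    IsDeWittOpen (i.coord '' (i.dom ∩ bodyPt ⁻¹' B)) := by
  refine ⟨_, (isOpen_Ioo (a := (-1 : ℝ)) (b := 1)).inter
    (hB.preimage (continuous_circ.comp i.continuous_branch)), ?_⟩
  ext s
  simp only [Set.mem_image, Set.mem_inter_iff, Set.mem_preimage, Set.mem_ofPred_eq,
    Function.comp_apply]
  constructor
  · rintro ⟨p, ⟨hp, hpB⟩, rfl⟩
    rw [bodyPt_eq hp] at hpB
    exact ⟨body_coord_mem hp, hpB⟩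
  · rintro ⟨hs, hsB⟩
    refine ⟨_, ⟨angle_branch_mem i hs, ?_⟩, coord_angle_branch i hs⟩
    rwa [bodyPt_angle, body_evenHat]

theorem dom_eq (i : Chart) : i.dom = bodyPt ⁻¹' i.side := Set.ext (mem_dom_iff i)

theorem isDeWittOpen_image_inter (i j : Chart) :
    IsDeWittOpen (i.coord '' (i.dom ∩ j.dom)) := by
  rw [dom_eq j]
  exact isDeWittOpen_image i j.isOpen_side

theorem exists_transition (i j : Chart) : ∃ f : R10 → RS,
    IsGInftyOn (i.coord '' (i.dom ∩ j.dom)) f ∧ ∀ p ∈ i.dom ∩ j.dom, (j.coord p : RS) = f (i.coord p) := by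
  refine ⟨hat (realFun fun t => j.trig (i.branch t)), ⟨_, ?_, fun _ _ => rfl⟩, ?_⟩
  · rintro _ ⟨p, ⟨hp, -⟩, rfl⟩
    exact smoothAt_realFun (j.contDiff_trig.contDiffAt.comp _
      (i.contDiffAt_branch (body_coord_mem hp)))
  · rintro p ⟨hp, -⟩
    conv_lhs => rw [← angle_branch_coord hp, coord_angle]
    rw [← evenHat_comp (i.contDiffAt_branch (body_coord_mem hp)) j.contDiff_trig.contDiffAt,
      coe_evenHat]

theorem isSupermanifold_charts : IsSupermanifold charts where
  cover := exists_mem_dom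
  injOn := injOn_coord
  isOpen_image i := by
    have := isDeWittOpen_image_inter i i
    rw [Set.inter_self] at this
    exact this
  isOpen_inter := isDeWittOpen_image_inter
  transition := exists_transition

/-! ### Supersmooth functions of the angle -/

theorem isDeWittOpen_preimage_angle {W : Set Supercircle} (hW : IsOpenIn charts W) :
    IsDeWittOpen (angle ⁻¹' W) := by
  choose O hO hWO using isOpenIn_iff.1 hW
  choose V hV hOV using hO
  refine ⟨⋃ i : Chart, i.trig ⁻¹' V i ∩ circ ⁻¹' i.side, isOpen_iUnion fun i =>
    ((hV i).preimage i.contDiff_trig.continuous).inter (i.isOpen_side.preimage continuous_circ), ?_⟩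
  ext θ
  have key : ∀ i : Chart, angle θ ∈ W ∩ i.dom ↔
      body (θ : RS) ∈ i.trig ⁻¹' V i ∩ circ ⁻¹' i.side := fun i => by
    rw [hWO, hOV, Set.mem_inter_iff, mem_dom_iff, bodyPt_angle, Set.mem_preimage, coord_angle,
      Set.mem_ofPred_eq, body_evenHat]
    rfl
  simp only [Set.mem_preimage, Set.mem_ofPred_eq, Set.mem_iUnion, ← key]
  obtain ⟨i, hi⟩ := exists_mem_dom (angle θ)
  exact ⟨fun h => ⟨i, h, hi⟩, fun ⟨_, h⟩ => h.1⟩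

theorem eventually_angle_real_mem {W : Set Supercircle} (hW : IsOpenIn charts W) {θ : R10}
    (hθ : angle θ ∈ W) : ∀ᶠ t in 𝓝 (body (θ : RS)), angle (real t) ∈ W := by
  obtain ⟨V, hV, e⟩ := isDeWittOpen_preimage_angle hW
  have h : ∀ θ' : R10, angle θ' ∈ W ↔ body (θ' : RS) ∈ V := fun θ' => by
    rw [← Set.mem_preimage, e]; rfl
  filter_upwards [hV.mem_nhds ((h θ).1 hθ)] with t ht
  rwa [h, body_real]

/-- A function on the supercircle as a function of a real angle. -/
noncomputable def pull (u : Supercircle → RS) (t : ℝ) : RS := u (angle (real t))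

/-- A function on the supercircle is `G^∞` if its pullback along the angle is one Grassmann analytic
continuation. -/
theorem gInftyOn_of_hat {W : Set Supercircle} {u : Supercircle → RS} {g : ℝ → RS}
    (h : ∀ θ, angle θ ∈ W → SmoothAt g (body (θ : RS)) ∧ u (angle θ) = hat g θ) :
    GInftyOn charts W u := by
  refine gInftyOn_iff.2 fun i => ?_
  refine ⟨hat fun t => g (i.branch t), ⟨_, ?_, fun _ _ => rfl⟩, ?_⟩
  · rintro _ ⟨p, ⟨hpW, hp⟩, rfl⟩
    have hg := (h (evenHat i.branch (i.coord p)) (by rwa [angle_branch_coord hp])).1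
    rw [body_evenHat] at hg
    exact hg.comp (i.contDiffAt_branch (body_coord_mem hp))
  · rintro p ⟨hpW, hp⟩
    obtain ⟨hg, hu⟩ := h (evenHat i.branch (i.coord p)) (by rwa [angle_branch_coord hp])
    rw [body_evenHat] at hg
    rw [angle_branch_coord hp] at hu
    rw [hu, hat_comp (i.contDiffAt_branch (body_coord_mem hp)) hg]

/-- The pullback of a `G^∞` function under the parametrization by the angle is the Grassmann analytic
continuation of its restriction to the real angles. -/
theorem hat_pull {W : Set Supercircle} (hW : IsOpenIn charts W) {u : Supercircle → RS}
    (hu : GInftyOn charts W u) {θ : R10} (hθ : angle θ ∈ W) :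
    SmoothAt (pull u) (body (θ : RS)) ∧ u (angle θ) = hat (pull u) θ := by
  obtain ⟨i, hi⟩ := exists_mem_dom (angle θ)
  obtain ⟨f, ⟨g, hg, hfg⟩, huf⟩ := gInftyOn_iff.1 hu i
  have hc : ContDiffAt ℝ ∞ i.trig (body (θ : RS)) := i.contDiff_trig.contDiffAt
  have hu' : ∀ θ', angle θ' ∈ W ∩ i.dom → u (angle θ') = hat g (evenHat i.trig θ') :=
    fun θ' h => by rw [huf _ h, hfg _ ⟨_, h, rfl⟩, coord_angle]
  have hgθ : SmoothAt g (i.trig (body (θ : RS))) := by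
    have := hg _ ⟨_, ⟨hθ, hi⟩, rfl⟩
    rwa [coord_angle, body_evenHat] at this
  have hW' : IsOpenIn charts (W ∩ i.dom) := by
    rw [dom_eq]
    exact hW.inter (isOpenIn_bodyPt i.isOpen_side)
  have e : (fun t => g (i.trig t)) =ᶠ[𝓝 (body (θ : RS))] pull u := by
    filter_upwards [eventually_angle_real_mem hW' ⟨hθ, hi⟩] with t ht
    rw [pull, hu' _ ht, evenHat_real, hat_real]
  refine ⟨fun l => (hgθ.comp hc l).congr_of_eventuallyEq ?_, ?_⟩
  · filter_upwards [e] with t ht using by rw [← ht]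
  · rw [hu' θ ⟨hθ, hi⟩, ← hat_congr e, hat_comp hc hgθ]

theorem eventually_smoothAt_pull {p : Supercircle} (u : gInftyAt charts p) {θ : R10}
    (hθ : angle θ = p) :
    (∀ᶠ t in 𝓝 (body (θ : RS)), SmoothAt (pull u) t) ∧ (u : Supercircle → RS) p = hat (pull u) θ := by
  obtain ⟨u, W, hW, hp, hu⟩ := u
  subst hθ
  refine ⟨?_, (hat_pull hW hu hp).2⟩
  filter_upwards [eventually_angle_real_mem hW hp] with t ht
  simpa using (hat_pull hW hu ht).1

/-! ### Superderivations are determined by a coordinate -/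

theorem gInftyOn_coord (i : Chart) : GInftyOn charts Set.univ fun q => (i.coord q : RS) :=
  gInftyOn_of_hat fun θ _ => ⟨smoothAt_realFun i.contDiff_trig.contDiffAt, by
    rw [coord_angle, coe_evenHat]⟩

theorem gInftyOn_fx : GInftyOn charts Set.univ fx := gInftyOn_coord .ypos

theorem gInftyOn_fy : GInftyOn charts Set.univ fy := gInftyOn_coord .xpos

/-- The coordinate of a chart, as a function that is `G^∞` near `p`. -/
def coordAt (i : Chart) (p : Supercircle) : gInftyAt charts p :=
  ⟨fun q => (i.coord q : RS), Set.univ, isOpenIn_univ _, trivial, gInftyOn_coord i⟩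

theorem isOpenIn_coord (i : Chart) {V : Set ℝ} (hV : IsOpen V) :
    IsOpenIn charts {q | body (i.coord q : RS) ∈ V} := by
  cases i
  · exact isOpenIn_bodyPt (hV.preimage continuous_snd)
  · exact isOpenIn_bodyPt (hV.preimage continuous_snd)
  · exact isOpenIn_bodyPt (hV.preimage continuous_fst)
  · exact isOpenIn_bodyPt (hV.preimage continuous_fst)

/-- The Grassmann analytic continuation of a function that is smooth near the body of the coordinate of
`p`, as a function on the supercircle. -/
noncomputable def hatAt (i : Chart) (p : Supercircle) (g : ℝ → RS)
    (hg : ∀ᶠ t in 𝓝 (body (i.coord p : RS)), SmoothAt g t) : gInftyAt charts p :=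
  ⟨fun q => hat g (i.coord q), by
    obtain ⟨V, hVg, hV, hpV⟩ := eventually_nhds_iff.1 hg
    refine ⟨_, isOpenIn_coord i hV, hpV, gInftyOn_of_hat (g := fun t => g (i.trig t)) fun θ hθ => ?_⟩
    rw [Set.mem_ofPred_eq, coord_angle, body_evenHat] at hθ
    have hc : ContDiffAt ℝ ∞ i.trig (body (θ : RS)) := i.contDiff_trig.contDiffAt
    exact ⟨(hVg _ hθ).comp hc, by rw [coord_angle, hat_comp hc (hVg _ hθ)]⟩⟩

/-- The chain rule for a superderivation. The difference of both sides for `g` is the soul of the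
coordinate of `p` times the difference for the difference quotient of `g`. -/
theorem map_hatAt {i : Chart} {p : Supercircle} {d : ZMod 2} {D : gInftyAt charts p → RS}
    (hD : IsSuperDerivation charts p d D) (g : ℝ → RS)
    (hg : ∀ᶠ t in 𝓝 (body (i.coord p : RS)), SmoothAt g t) :
    D (hatAt i p g hg) = D (coordAt i p) * hat (realDeriv 1 g) (i.coord p) := by
  set z := i.coord p with hz
  set a := body (z : RS) with ha
  refine sub_eq_zero.1 (eq_zero_of_soul_mul
    (α := {g : ℝ → RS // ∀ᶠ t in 𝓝 a, SmoothAt g t}) (P := fun _ => True)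
    (E := fun g => D (hatAt i p g.1 g.2) - D (coordAt i p) * hat (realDeriv 1 g.1) z)
    (body_soul (z : RS)) (fun ⟨g, hg⟩ _ => ?_) ⟨g, hg⟩ trivial)
  have hq : ∀ᶠ t in 𝓝 a, SmoothAt (quot g a) t := hg.mono fun t ht => hg.self_of_nhds.quot ht
  refine ⟨⟨quot g a, hq⟩, trivial, ?_⟩
  set s : gInftyAt charts p := coordAt i p + constAt charts p (algebraMap ℝ RS (-a)) with hs
  have hs_apply : ∀ q, (s : Supercircle → RS) q = i.coord q - algebraMap ℝ RS a := fun q => by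
    rw [map_neg] at hs
    rw [hs, sub_eq_add_neg]; rfl
  have hs0 : ∀ q, (s : Supercircle → RS) q ∈ part 0 := fun q => by
    rw [hs_apply]
    exact (part 0).sub_mem (i.coord q).2 (evenSubalgebra.algebraMap_mem _)
  obtain ⟨V, hVg, hV, hpV⟩ := eventually_nhds_iff.1 hg
  have e : D (hatAt i p g hg) = D (constAt charts p (g a) + s * hatAt i p (quot g a) hq) := by
    refine hD.congr (isOpenIn_coord i hV) hpV fun q hq => ?_
    change hat g (i.coord q) = g a + (s : Supercircle → RS) q * hat (quot g a) (i.coord q)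
    rw [hs_apply, hat_eq_add_mul_hat_quot hg.self_of_nhds (hVg _ hq)]
  have hsp : (s : Supercircle → RS) p = soul (z : RS) := hs_apply p
  have hDs : D s = D (coordAt i p) := by rw [hs, hD.map_add, hD.map_const, add_zero]
  have hqp : (hatAt i p (quot g a) hq : Supercircle → RS) p = hat (quot g a) z := rfl
  dsimp only
  rw [e, hD.map_add, hD.map_const, hD.leibniz_even _ _ hs0, hsp, hDs, hqp, hat_realDeriv_eq hg,
    mul_add, mul_sub, ← mul_assoc _ (soul (z : RS)), ← even_comm (soul_mem z) (D (coordAt i p)),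
    ← ha, mul_assoc]
  abel

theorem eventually_smoothAt_pull_branch {i : Chart} {p : Supercircle} (hp : p ∈ i.dom)
    (u : gInftyAt charts p) :
    ∀ᶠ t in 𝓝 (body (i.coord p : RS)), SmoothAt (fun t => pull u (i.branch t)) t := by
  have h := (eventually_smoothAt_pull u (angle_branch_coord hp)).1
  rw [body_evenHat] at h
  filter_upwards [i.continuous_branch.continuousAt.eventually h,
    isOpen_Ioo.mem_nhds (body_coord_mem hp)] with t ht ht'
  exact ht.comp (i.contDiffAt_branch ht')

/-- A superderivation is determined by its value on the coordinate of a chart. -/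
theorem map_eq_map_coord_mul {i : Chart} {p : Supercircle} (hp : p ∈ i.dom) {d : ZMod 2}
    {D : gInftyAt charts p → RS} (hD : IsSuperDerivation charts p d D) (u : gInftyAt charts p) :
    D u = D (coordAt i p) * hat (realDeriv 1 fun t => pull u (i.branch t)) (i.coord p) := by
  rw [← map_hatAt hD _ (eventually_smoothAt_pull_branch hp u)]
  obtain ⟨W, hW, hpW, hu⟩ := u.2
  have hW' : IsOpenIn charts (W ∩ i.dom) := by
    rw [dom_eq]
    exact hW.inter (isOpenIn_bodyPt i.isOpen_side)
  refine hD.congr hW' ⟨hpW, hp⟩ fun q hq => ?_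
  change (u : Supercircle → RS) q = hat (fun t => pull u (i.branch t)) (i.coord q)
  have hqW : angle (evenHat i.branch (i.coord q)) ∈ W := by rw [angle_branch_coord hq.2]; exact hq.1
  obtain ⟨h1, h2⟩ := hat_pull hW hu hqW
  rw [body_evenHat] at h1
  rw [angle_branch_coord hq.2] at h2
  rw [h2, hat_comp (i.contDiffAt_branch (body_coord_mem hq.2)) h1]

/-! ### The derivative along the angle -/

/-- The derivative along the angle, at the angle `θ`. -/
noncomputable def angleDeriv (θ : R10) (u : Supercircle → RS) : RS := hat (realDeriv 1 (pull u)) θ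

theorem isSuperDerivation_angleDeriv {θ : R10} {p : Supercircle} (hθ : angle θ = p) :
    IsSuperDerivation charts p 0 fun u => angleDeriv θ u where
  map_add u v :=
    hat_realDeriv_add (eventually_smoothAt_pull u hθ).1 (eventually_smoothAt_pull v hθ).1
  map_mul_const u c := by
    have := hat_realDeriv_mul (eventually_smoothAt_pull u hθ).1
      (.of_forall fun t => SmoothAt.const c t)
    rw [hat_realDeriv_const, hat_const, mul_zero, add_zero] at this
    exact this
  degree e u hu := by
    rw [zero_add]
    exact hat_realDeriv_mem_part (fun t => hu _) θ
  leibniz e u v hu := by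
    have h1 := eventually_smoothAt_pull u hθ
    have h2 := eventually_smoothAt_pull v hθ
    have hk : koszul 0 e = 1 := by simp [koszul]
    rw [hk, one_smul, h1.2, h2.2]
    exact hat_realDeriv_mul h1.1 h2.1

theorem angleDeriv_fx (θ : R10) : angleDeriv θ fx = -(angle θ).fy := by
  have : pull fx = realFun Real.cos := funext fun t => hat_real _ t
  rw [angleDeriv, this, realDeriv_realFun_cos, hat_neg (smoothAt_realFun_sin _)]
  rfl

theorem angleDeriv_fy (θ : R10) : angleDeriv θ fy = (angle θ).fx := by
  have : pull fy = realFun Real.sin := funext fun t => hat_real _ t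
  rw [angleDeriv, this, realDeriv_realFun_sin]
  rfl

theorem fx_mem (p : Supercircle) : fx ∈ gInftyAt charts p :=
  ⟨Set.univ, isOpenIn_univ _, trivial, gInftyOn_fx⟩

theorem fy_mem (p : Supercircle) : fy ∈ gInftyAt charts p :=
  ⟨Set.univ, isOpenIn_univ _, trivial, gInftyOn_fy⟩

theorem fx_mem_part (p : Supercircle) : p.fx ∈ part 0 := p.x.2

theorem fy_mem_part (p : Supercircle) : p.fy ∈ part 0 := p.y.2

theorem fx_mul_fx_add_fy_mul_fy (p : Supercircle) : p.fx * p.fx + p.fy * p.fy = 1 := by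
  have := congrArg (fun a : R10 => (a : RS)) p.2
  simpa [pow_two, fx, fy, x, y] using this

/-- The parameter `λ` with `D x = -λ y` and `D y = λ x`, for a tangent vector `D` at `p`. -/
noncomputable def slopeAt (p : Supercircle) (D : gInftyAt charts p → RS) : RS :=
  D ⟨fy, fy_mem p⟩ * p.fx - D ⟨fx, fx_mem p⟩ * p.fy

theorem slopeAt_add (p : Supercircle) (D E : gInftyAt charts p → RS) :
    slopeAt p (D + E) = slopeAt p D + slopeAt p E := by
  simp only [slopeAt, Pi.add_apply, add_mul]; abel

theorem slopeAt_smul (p : Supercircle) (c : RS) (D : gInftyAt charts p → RS) :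
    slopeAt p (c • D) = c * slopeAt p D := by
  simp only [slopeAt, Pi.smul_apply, smul_eq_mul, mul_sub, mul_assoc]

theorem slopeAt_angleDeriv {θ : R10} {p : Supercircle} (hθ : angle θ = p) :
    slopeAt p (fun u => angleDeriv θ u) = 1 := by
  rw [slopeAt, angleDeriv_fx, angleDeriv_fy, hθ, neg_mul, sub_neg_eq_add, fx_mul_fx_add_fy_mul_fy]

section

variable {p : Supercircle} {d : ZMod 2} {D : gInftyAt charts p → RS}

theorem map_fx_mul_fx_add (hD : IsSuperDerivation charts p d D) :
    D ⟨fx, fx_mem p⟩ * p.fx + D ⟨fy, fy_mem p⟩ * p.fy = 0 := by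
  set a : gInftyAt charts p := ⟨fx, fx_mem p⟩ with ha
  set b : gInftyAt charts p := ⟨fy, fy_mem p⟩ with hb
  have e : a * a + b * b = constAt charts p 1 :=
    Subtype.ext (funext fun q => fx_mul_fx_add_fy_mul_fy q)
  have h := hD.map_const 1
  rw [← e, hD.map_add, hD.leibniz_even a a fx_mem_part, hD.leibniz_even b b fy_mem_part] at h
  change D a * p.fx + p.fx * D a + (D b * p.fy + p.fy * D b) = 0 at h
  rw [even_comm (fx_mem_part p), even_comm (fy_mem_part p)] at h
  -- Both factors of `x * x` and `y * y` are even, so differentiating `x² + y² = 1` gives twice the claim.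
  have h2 : (2 : ℝ) • (D a * p.fx + D b * p.fy) = 0 := by
    rw [two_smul, ← h]; abel
  exact (smul_eq_zero_iff_right two_ne_zero).1 h2

theorem map_fx_eq (hD : IsSuperDerivation charts p d D) :
    D ⟨fx, fx_mem p⟩ = -(slopeAt p D * p.fy) := by
  have h1 := map_fx_mul_fx_add hD
  have h2 := fx_mul_fx_add_fy_mul_fy p
  rw [slopeAt]
  set A := D ⟨fx, fx_mem p⟩
  set B := D ⟨fy, fy_mem p⟩
  calc A = A * (p.fx * p.fx + p.fy * p.fy) - (A * p.fx + B * p.fy) * p.fx := by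
        rw [h1, h2, mul_one, zero_mul, sub_zero]
    _ = A * p.fy * p.fy - B * (p.fy * p.fx) := by noncomm_ring
    _ = A * p.fy * p.fy - B * (p.fx * p.fy) := by rw [even_comm (fx_mem_part p)]
    _ = -((B * p.fx - A * p.fy) * p.fy) := by noncomm_ring

theorem map_fy_eq (hD : IsSuperDerivation charts p d D) :
    D ⟨fy, fy_mem p⟩ = slopeAt p D * p.fx := by
  have h1 := map_fx_mul_fx_add hD
  have h2 := fx_mul_fx_add_fy_mul_fy p
  rw [slopeAt]
  set A := D ⟨fx, fx_mem p⟩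
  set B := D ⟨fy, fy_mem p⟩
  calc B = B * (p.fx * p.fx + p.fy * p.fy) - (A * p.fx + B * p.fy) * p.fy := by
        rw [h1, h2, mul_one, zero_mul, sub_zero]
    _ = B * p.fx * p.fx - A * (p.fx * p.fy) := by noncomm_ring
    _ = B * p.fx * p.fx - A * (p.fy * p.fx) := by rw [even_comm (fx_mem_part p)]
    _ = (B * p.fx - A * p.fy) * p.fx := by noncomm_ring

theorem map_coordAt_eq (i : Chart) {θ : R10} (hθ : angle θ = p)
    (hD : IsSuperDerivation charts p d D) :
    D (coordAt i p) = slopeAt p D * angleDeriv θ (coordAt i p) := by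
  have hx : D ⟨fx, fx_mem p⟩ = slopeAt p D * angleDeriv θ fx := by
    rw [map_fx_eq hD, angleDeriv_fx, hθ, mul_neg]
  have hy : D ⟨fy, fy_mem p⟩ = slopeAt p D * angleDeriv θ fy := by
    rw [map_fy_eq hD, angleDeriv_fy, hθ]
  cases i
  · exact hy
  · exact hy
  · exact hx
  · exact hx

/-- A superderivation at a point is a multiple of the derivative along the angle. -/
theorem map_eq_slopeAt_mul {θ : R10} (hθ : angle θ = p) (hD : IsSuperDerivation charts p d D)
    (u : gInftyAt charts p) : D u = slopeAt p D * angleDeriv θ u := by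
  obtain ⟨i, hi⟩ := exists_mem_dom p
  rw [map_eq_map_coord_mul hi hD u, map_coordAt_eq i hθ hD,
    map_eq_map_coord_mul hi (isSuperDerivation_angleDeriv hθ) u, mul_assoc]

end

/-- The derivative along the angle does not depend on the choice of the angle of a point. -/
theorem angleDeriv_eq {θ η : R10} (h : angle θ = angle η) (u : gInftyAt charts (angle η)) :
    angleDeriv θ u = angleDeriv η u := by
  have := map_eq_slopeAt_mul (θ := η) rfl (isSuperDerivation_angleDeriv h) u
  rwa [slopeAt_angleDeriv h, one_mul] at this

/-- A tangent vector is a multiple of the derivative along the angle, as this holds for its even and its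
odd part. -/
theorem tangent_eq {p : Supercircle} {θ : R10} (hθ : angle θ = p) (v : SuperTangentSpace charts p)
    (u : gInftyAt charts p) : v.1 u = slopeAt p v.1 * angleDeriv θ u := by
  obtain ⟨D₀, D₁, h₀, h₁, e⟩ := v.2
  rw [e, slopeAt_add, add_mul, Pi.add_apply, ← map_eq_slopeAt_mul hθ h₀, ← map_eq_slopeAt_mul hθ h₁]

/-! ### The trivialization -/

/-- An angle of a point. -/
noncomputable def arg : Supercircle → R10 := Function.surjInv angle_surjective

theorem angle_arg (p : Supercircle) : angle (arg p) = p := Function.surjInv_eq angle_surjective p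

/-- The rotational tangent vector at `p`. -/
noncomputable def rotation (p : Supercircle) : SuperTangentSpace charts p :=
  ⟨fun u => angleDeriv (arg p) u, fun u => angleDeriv (arg p) u, 0,
    isSuperDerivation_angleDeriv (angle_arg p), IsSuperDerivation.zero _ _ _, (add_zero _).symm⟩

theorem slopeAt_rotation (p : Supercircle) : slopeAt p (rotation p).1 = 1 :=
  slopeAt_angleDeriv (angle_arg p)

theorem eq_smul_rotation {p : Supercircle} (v : SuperTangentSpace charts p) :
    v = slopeAt p v.1 • rotation p :=
  Subtype.ext (funext fun u => tangent_eq (angle_arg p) v u)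

/-- The trivialization of the tangent bundle by the rotational vector field. -/
noncomputable def trivialization : SuperTangentBundle charts ≃ Supercircle × RS where
  toFun v := (v.1, slopeAt v.1 v.2.1)
  invFun q := ⟨q.1, q.2 • rotation q.1⟩
  left_inv v := by
    obtain ⟨p, v⟩ := v
    simp only [← eq_smul_rotation]
  right_inv q := by
    obtain ⟨p, c⟩ := q
    have : slopeAt p (c • rotation p : SuperTangentSpace charts p).1 = c := by
      rw [Submodule.coe_smul, slopeAt_smul, slopeAt_rotation, mul_one]
    simp only [this]

theorem trivialization_snd (p : Supercircle) (v : SuperTangentSpace charts p) :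
    (trivialization ⟨p, v⟩).2 = slopeAt p v.1 := rfl

theorem isSuperDerivation_iff {p : Supercircle} (d : ZMod 2) (v : SuperTangentSpace charts p) :
    IsSuperDerivation charts p d v.1 ↔ slopeAt p v.1 ∈ part d := by
  constructor
  · intro h
    refine (part d).sub_mem ?_ ?_
    · simpa using mul_mem_part (h.degree 0 ⟨fy, fy_mem p⟩ fy_mem_part) (fx_mem_part p)
    · simpa using mul_mem_part (h.degree 0 ⟨fx, fx_mem p⟩ fx_mem_part) (fy_mem_part p)
  · intro h
    have := (isSuperDerivation_angleDeriv (angle_arg p)).smul h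
    rw [add_zero] at this
    rw [eq_smul_rotation v]
    exact this

theorem gInftyOn_angleDeriv {W : Set Supercircle} (hW : IsOpenIn charts W) {u : Supercircle → RS}
    (hu : GInftyOn charts W u) : GInftyOn charts W fun p => angleDeriv (arg p) u :=
  gInftyOn_of_hat (g := realDeriv 1 (pull u)) fun _ hθ => ⟨(hat_pull hW hu hθ).1.realDeriv_one,
    angleDeriv_eq (angle_arg _) ⟨u, W, hW, hθ, hu⟩⟩

theorem isGInftyField_iff {W : Set Supercircle} (hW : IsOpenIn charts W)
    (Y : ∀ p : Supercircle, SuperTangentSpace charts p) :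
    IsGInftyField charts W Y ↔ GInftyOn charts W fun p => slopeAt p (Y p).1 := by
  constructor
  · intro h
    have hx := gInftyOn_fx.mono (Set.subset_univ W)
    have hy := gInftyOn_fy.mono (Set.subset_univ W)
    obtain ⟨a, ha, hYa⟩ := h W subset_rfl hW fx hx
    obtain ⟨b, hb, hYb⟩ := h W subset_rfl hW fy hy
    refine ((hb.mul hx).add ((GInftyOn.const charts W (-1)).mul (ha.mul hy))).congr fun p hp => ?_
    simp only [slopeAt, Pi.add_apply, Pi.mul_apply, ← hYa p hp, ← hYb p hp]
    rw [neg_one_mul, sub_eq_add_neg]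
  · intro h W' hWW hW' u hu
    exact ⟨_, (h.mono hWW).mul (gInftyOn_angleDeriv hW' hu), fun p hp =>
      tangent_eq (angle_arg p) (Y p) _⟩

theorem isTrivialization_trivialization : IsTrivialization charts trivialization where
  base _ := rfl
  map_add p v w := slopeAt_add p v.1 w.1
  map_smul p c v := slopeAt_smul p c v.1
  degree d _ v := isSuperDerivation_iff d v
  smooth _ hW Y := isGInftyField_iff hW Y

theorem tangent_fx {p : Supercircle} (v : SuperTangentSpace charts p) :
    v.1 ⟨fx, fx_mem p⟩ = -(slopeAt p v.1 * p.fy) := by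
  rw [tangent_eq (angle_arg p) v, angleDeriv_fx, angle_arg, mul_neg]

theorem tangent_fy {p : Supercircle} (v : SuperTangentSpace charts p) :
    v.1 ⟨fy, fy_mem p⟩ = slopeAt p v.1 * p.fx := by
  rw [tangent_eq (angle_arg p) v, angleDeriv_fy, angle_arg]

end Supercircle

end SuperGeom

/-- The supercircle is a `(1,0)`-dimensional supermanifold, the super cosine and sine parametrize it, and
its tangent bundle is the set of all `(x, y, -λ y, λ x)` and is trivial through the parameter `λ`. -/
theorem proposition4p4 :
    IsSupermanifold Supercircle.charts ∧
    (∀ θ : R10, RS.FormallySummable (sinTerm θ) ∧ RS.FormallySummable (cosTerm θ)) ∧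
    (HasSuperDerivOn Set.univ sinBar cosBar ∧
      HasSuperDerivOn Set.univ cosBar (fun θ => -sinBar θ)) ∧
    (∃ γ : R10 → Supercircle,
      (∀ θ, (γ θ).fx = cosBar θ ∧ (γ θ).fy = sinBar θ) ∧ Function.Surjective γ) ∧
    ∃ (hx : ∀ p, Supercircle.fx ∈ gInftyAt Supercircle.charts p)
      (hy : ∀ p, Supercircle.fy ∈ gInftyAt Supercircle.charts p),
      (Function.Injective
          (fun v : SuperTangentBundle Supercircle.charts =>
            (v.1, v.2.1 ⟨Supercircle.fx, hx v.1⟩, v.2.1 ⟨Supercircle.fy, hy v.1⟩)) ∧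
        Set.range
          (fun v : SuperTangentBundle Supercircle.charts =>
            (v.1, v.2.1 ⟨Supercircle.fx, hx v.1⟩, v.2.1 ⟨Supercircle.fy, hy v.1⟩)) =
          {q : Supercircle × RS × RS |
            ∃ (p : Supercircle) (c : RS), q = (p, -(c * p.fy), c * p.fx)}) ∧
      ∃ Φ : SuperTangentBundle Supercircle.charts ≃ Supercircle × RS,
        IsTrivialization Supercircle.charts Φ ∧
        ∀ (p : Supercircle) (v : SuperTangentSpace Supercircle.charts p),
          v.1 ⟨Supercircle.fx, hx p⟩ = -((Φ ⟨p, v⟩).2 * p.fy) ∧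
          v.1 ⟨Supercircle.fy, hy p⟩ = (Φ ⟨p, v⟩).2 * p.fx := by
  refine ⟨Supercircle.isSupermanifold_charts,
    fun θ => ⟨fun l => (hasSum_sinTerm θ l).summable, fun l => (hasSum_cosTerm θ l).summable⟩,
    ⟨hasSuperDerivOn_sinBar, hasSuperDerivOn_cosBar⟩,
    ⟨Supercircle.angle, fun θ => ⟨(cosBar_eq_hat θ).symm, (sinBar_eq_hat θ).symm⟩,
      Supercircle.angle_surjective⟩,
    Supercircle.fx_mem, Supercircle.fy_mem, ⟨?_, ?_⟩, Supercircle.trivialization,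
    Supercircle.isTrivialization_trivialization,
    fun p v => ⟨Supercircle.tangent_fx v, Supercircle.tangent_fy v⟩⟩
  · rintro ⟨p, v⟩ ⟨q, w⟩ h
    obtain ⟨rfl, h⟩ := Prod.mk.inj h
    obtain ⟨h1, h2⟩ := Prod.mk.inj h
    refine Supercircle.trivialization.injective (Prod.ext rfl ?_)
    simp only [Supercircle.trivialization_snd, Supercircle.slopeAt]
    rw [h1, h2]
  · ext q
    constructor
    · rintro ⟨⟨p, v⟩, rfl⟩
      exact ⟨p, Supercircle.slopeAt p v.1, by
        simp only [Supercircle.tangent_fx, Supercircle.tangent_fy]⟩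
    · rintro ⟨p, c, rfl⟩
      obtain ⟨⟨q, v⟩, hv⟩ := Supercircle.trivialization.surjective (p, c)
      obtain ⟨rfl, rfl⟩ := Prod.mk.inj hv
      exact ⟨⟨q, v⟩, by simp only [Supercircle.tangent_fx, Supercircle.tangent_fy]⟩
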